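/- **Setting.** Let $N\ge 1$. A lower triangular matrix $H=[h_{k,j}]\in\mathbb R^{(N-1)\times(N-1)}$ defines, for an operator $T$ on a real Hilbert space and a starting point $y_0$, the iterates $$y_{k+1}=y_k-\sum_{j=0}^{k}h_{k+1,j+1}\,(y_j-Ty_j),\qquad k=0,\dots,N-2 .$$ Let $\mathcal H_\star(N-1)$ be the set of all lower triangular $H\in\mathbb R^{(N-1)\times(N-1)}$ such that $\|y_{N-1}-Ty_{N-1}\|^2\le \frac{4}{N^2}\|y_0-y_\star\|^2$ for every nonexpansive $T$ on a real Hilbert space, every fixed point $y_\star$ of $T$ and every $y_0$. (For $N=1$ it consists of the $0\times0$ matrix $[\,\,]$.) For $m,j\in\{1,\dots,N-1\}$ put $$Q(m,j;H)=\sum_{j=j(1)\le i(1)<j(2)\le i(2)<\cdots<j(m)\le i(m)\le N-1}\ \prod_{r=1}^m h_{i(r),j(r)},$$ and define the H-certificates $\lambda^\star_{k,j}(H)$, $1\le j<k\le N$, by $$\lambda^\star_{N,j}(H)=N\sum_{m=1}^{N-1}(-1)^{m-1}Q(m,j;H),\qquad \lambda^\star_{k,j}(H)=N\sum_{\ell=1}^{N-1}\sum_{m=1}^{N-1}(-1)^{\ell+m-1}\binom{\ell+m}{m}Q(\ell,j;H)\,Q(m,k;H)\quad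 (k<N).$$ A *vertex* of $\mathcal H_\star(N-1)$ is an $H\in\mathcal H_\star(N-1)$ for which the number of pairs $j<k$ with $\lambda^\star_{k,j}(H)=0$ is the largest possible among elements of $\mathcal H_\star(N-1)$. The arc diagram of a vertex $H$ is the graph on the nodes $1,\dots,N$ with an arc $(k,j)$, $j<k$, whenever $\lambda^\star_{k,j}(H)>0$. For $1\le N'\le N-1$, $H_1\in\mathcal H_\star(N'-1)$ and $H_2\in\mathcal H_\star(N-N'-1)$, the *gluing* $H_1\bowtie H_2=[h_{k,j}]$ is the lower triangular $(N-1)\times(N-1)$ matrix whose first $N'-1$ rows and columns form $H_1$, whose last $N-N'-1$ rows and columns form $H_2$, whose entries in rows $>N'$ and columns $<N'$ vanish, with $$h_{N',j}=-\frac{N-N'}{N}\sum_{k=j}^{N'-1}(H_1)_{k,j}\ (j<N'),\qquad h_{N',N'}=\frac{N'(N-N')}{N},$$ and whose remaining entries $h_{N'+1,N'},\dots,h_{N-1,N'}$ are the unique values satisfying $$Q(k,N';H_1\bowtie H_2)=\frac{N'(N-N'+1)}{N(k+1)}\binom{N-N'-1}{k-1},\qquad k=1,\dots,N-N'.$$ The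 $0\times0$ matrix is *basic*; recursively, a matrix is *basic* if it is a gluing $H_1\bowtie H_2$ of basic matrices $H_1,H_2$. **Proposition.** Let $N\ge1$ and $H\in\mathbb R^{(N-1)\times(N-1)}$. If $H$ is a vertex of $\mathcal H_\star(N-1)$, then for each $j\in\{1,\dots,N-1\}$ there is exactly one arc $(k(j),j)$ with $k(j)>j$ in its arc diagram. Moreover, $H$ is basic if and only if it is a vertex of $\mathcal H_\star(N-1)$ and its arc diagram is non-crossing, i.e., there are no indices $j_1<j_2$ with $j_1<j_2<k(j_1)<k(j_2)$. -/

import Mathlib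

/-!
Throughout, an algorithm with `N` operator evaluations is encoded by an `n × n` step-size matrix,
`n = N - 1`.  Matrix rows and columns `1, …, N - 1` become `Fin n`, and the nodes `1, …, N` of a
diagram become `Fin (n + 1)`; both are numbered from `0`, so node `N` is `Fin.last n`, and column
`j : Fin n` is identified with node `j.castSucc`.
-/

namespace FixedPointAlg

/-- `H` is lower triangular: `h k j = 0` for `j > k`. -/
def IsLowerTri {n : ℕ} (H : Matrix (Fin n) (Fin n) ℝ) : Prop :=
  ∀ k j : Fin n, k < j → H k j = 0

/-- `y 0, …, y n` are the iterates of the algorithm with step-size matrix `H` applied to `T`: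
`y (k+1) = y k - ∑_{j ≤ k} h (k+1) (j+1) • (y j - T (y j))` for `k = 0, …, n - 1`
(one-based matrix indices in this formula). -/
def IsTrajectory {X : Type} [NormedAddCommGroup X] [InnerProductSpace ℝ X] {n : ℕ}
    (H : Matrix (Fin n) (Fin n) ℝ) (T : X → X) (y : Fin (n + 1) → X) : Prop :=
  ∀ k : Fin n, y k.succ =
    y k.castSucc - ∑ j ∈ Finset.Iic k, H k j • (y j.castSucc - T (y j.castSucc))

/-- The set `ℋ⋆(n)`, `n = N - 1`, of minimax optimal H-matrices: lower triangular matrices whose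
algorithm satisfies `‖y_{N-1} - T y_{N-1}‖² ≤ 4 ‖y_0 - y⋆‖² / N²` for every nonexpansive operator
`T` on a real Hilbert space, every fixed point `y⋆` of `T` and every starting point. -/
def optimalSet (n : ℕ) : Set (Matrix (Fin n) (Fin n) ℝ) :=
  {H | IsLowerTri H ∧
    ∀ (X : Type) [NormedAddCommGroup X] [InnerProductSpace ℝ X] [CompleteSpace X]
      (T : X → X), LipschitzWith 1 T → ∀ ystar : X, T ystar = ystar →
      ∀ y : Fin (n + 1) → X, IsTrajectory H T y →
        ‖y (Fin.last n) - T (y (Fin.last n))‖ ^ 2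
          ≤ 4 * ‖y 0 - ystar‖ ^ 2 / ((n : ℝ) + 1) ^ 2}

/-- The Q-function `Q(m, j; H)` for `m ≥ 1`: the sum of the products
`h (i 1) (j 1) * ⋯ * h (i m) (j m)` over all chains
`j = j 1 ≤ i 1 < j 2 ≤ i 2 < ⋯ < j m ≤ i m` of indices, organised by the first factor of the
product.  The value at `m = 0` is never used. -/
def Q {n : ℕ} (H : Matrix (Fin n) (Fin n) ℝ) : ℕ → Fin n → ℝ
  | 0, _ => 0
  | 1, j => ∑ i ∈ Finset.Ici j, H i j
  | m + 2, j => ∑ i ∈ Finset.Ici j, H i j * ∑ j' ∈ Finset.Ioi i, Q H (m + 1) j'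

/-- The H-certificate `λ⋆_{k,j}(H)`, meaningful for `j < k`. For `k = N` it is
`N ∑_m (-1)^(m-1) Q(m,j)`, and for `k < N` it is
`N ∑_l ∑_m (-1)^(l+m-1) (l+m choose m) Q(l,j) Q(m,k)`, with `l, m` from `1` to `N - 1`. -/
noncomputable def cert {n : ℕ} (H : Matrix (Fin n) (Fin n) ℝ) (k : Fin (n + 1)) (j : Fin n) : ℝ :=
  Fin.lastCases (motive := fun _ => ℝ)
    (((n : ℝ) + 1) * ∑ m ∈ Finset.Icc 1 n, (-1 : ℝ) ^ (m - 1) * Q H m j)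
    (fun k' : Fin n => ((n : ℝ) + 1) * ∑ l ∈ Finset.Icc 1 n, ∑ m ∈ Finset.Icc 1 n,
      (-1 : ℝ) ^ (l + m - 1) * ((l + m).choose m : ℝ) * Q H l j * Q H m k')
    k

/-- The pairs `(j, k)` with `j < k` whose H-certificate vanishes at `H`. -/
def zeroCerts {n : ℕ} (H : Matrix (Fin n) (Fin n) ℝ) : Set (Fin n × Fin (n + 1)) :=
  {p | p.1.castSucc < p.2 ∧ cert H p.2 p.1 = 0}

/-- `H` is a vertex of `ℋ⋆(n)`: a point of `ℋ⋆(n)` that lies on a maximal number of the zero sets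
of the H-certificates. -/
def IsVertex {n : ℕ} (H : Matrix (Fin n) (Fin n) ℝ) : Prop :=
  H ∈ optimalSet n ∧ ∀ H' ∈ optimalSet n, (zeroCerts H').ncard ≤ (zeroCerts H).ncard

/-- `(k, j)`, `j < k`, is an arc of the diagram `𝒢(H)`: its weight `λ⋆_{k,j}(H)` is positive. -/
def IsArc {n : ℕ} (H : Matrix (Fin n) (Fin n) ℝ) (j : Fin n) (k : Fin (n + 1)) : Prop :=
  j.castSucc < k ∧ 0 < cert H k j

/-- No two arcs `(k₁, j₁)`, `(k₂, j₂)` of the diagram satisfy `j₁ < j₂ < k₁ < k₂`. -/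
def NonCrossing {n : ℕ} (H : Matrix (Fin n) (Fin n) ℝ) : Prop :=
  ∀ (j₁ j₂ : Fin n) (k₁ k₂ : Fin (n + 1)), IsArc H j₁ k₁ → IsArc H j₂ k₂ →
    ¬ (j₁ < j₂ ∧ j₂.castSucc < k₁ ∧ k₁ < k₂)

section Gluing

variable {a b : ℕ}

/-- Index in the first block of `a + 1 + b` indices. -/
def leftIdx (b : ℕ) (i : Fin a) : Fin (a + 1 + b) := Fin.castAdd b i.castSucc

/-- The inserted index, between the two blocks. -/
def midIdx (a b : ℕ) : Fin (a + 1 + b) := Fin.castAdd b (Fin.last a)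

/-- Index in the last block of `a + 1 + b` indices. -/
def rightIdx (a : ℕ) (i : Fin b) : Fin (a + 1 + b) := Fin.natAdd (a + 1) i

/-- `H` is the gluing `H₁ ⋈ H₂` of `H₁ ∈ ℋ⋆(N' - 1)` and `H₂ ∈ ℋ⋆(N - N' - 1)`, where
`a = N' - 1` and `b = N - N' - 1`, so that `N = a + b + 2`, `N' = a + 1`, `N - N' = b + 1`. -/
structure IsGluing (H₁ : Matrix (Fin a) (Fin a) ℝ) (H₂ : Matrix (Fin b) (Fin b) ℝ)
    (H : Matrix (Fin (a + 1 + b)) (Fin (a + 1 + b)) ℝ) : Prop where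
  mem_left : H₁ ∈ optimalSet a
  mem_right : H₂ ∈ optimalSet b
  -- the first block row
  left_left : ∀ i j, H (leftIdx b i) (leftIdx b j) = H₁ i j
  left_mid : ∀ i, H (leftIdx b i) (midIdx a b) = 0
  left_right : ∀ (i : Fin a) (j : Fin b), H (leftIdx b i) (rightIdx a j) = 0
  -- the inserted row `N'`
  mid_left : ∀ j, H (midIdx a b) (leftIdx b j) =
    -(((b : ℝ) + 1) / ((a : ℝ) + b + 2)) * ∑ k ∈ Finset.Ici j, H₁ k j
  mid_mid : H (midIdx a b) (midIdx a b) =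
    ((a : ℝ) + 1) * ((b : ℝ) + 1) / ((a : ℝ) + b + 2)
  mid_right : ∀ j, H (midIdx a b) (rightIdx a j) = 0
  -- the last block row
  right_left : ∀ (i : Fin b) (j : Fin a), H (rightIdx a i) (leftIdx b j) = 0
  right_right : ∀ i j, H (rightIdx a i) (rightIdx a j) = H₂ i j
  -- the entries of column `N'` below the diagonal are determined by
  -- `Q(k, N') = N' (N - N' + 1) / (N (k + 1)) * (N - N' - 1 choose k - 1)`, `1 ≤ k ≤ N - N'`
  column : ∀ k ∈ Finset.Icc 1 (b + 1), Q H k (midIdx a b) =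
    ((a : ℝ) + 1) * ((b : ℝ) + 2) / (((a : ℝ) + b + 2) * ((k : ℝ) + 1)) * (b.choose (k - 1) : ℝ)

end Gluing

/-- Basic H-matrices: the empty matrix, and recursively every gluing of basic H-matrices. -/
inductive IsBasic : ∀ {n : ℕ}, Matrix (Fin n) (Fin n) ℝ → Prop
  | empty (H : Matrix (Fin 0) (Fin 0) ℝ) : IsBasic H
  | glue {a b : ℕ} (H₁ : Matrix (Fin a) (Fin a) ℝ) (H₂ : Matrix (Fin b) (Fin b) ℝ)
      (H : Matrix (Fin (a + 1 + b)) (Fin (a + 1 + b)) ℝ)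
      (h₁ : IsBasic H₁) (h₂ : IsBasic H₂) (h : IsGluing H₁ H₂ H) : IsBasic H

end FixedPointAlg

/-!
Put `N = n + 1` and attach to each node `j` a real polynomial `f_j` of degree at most `N - j` (nodes
numbered from `1`): `f_N = -1`, and `f_j = ∑_m (-1)^(m-1) Q(m, j; H) (1 - X)^m` for the other nodes.
By Vandermonde's identity the H-certificates are the entries of the Gram matrix of these polynomials
for the coefficientwise inner product, `λ⋆_{k,j}(H) = -N ⟨f_j, f_k⟩` (`cert_eq_ip`).  The polynomials
satisfy `f_j = -(1 - X) ∑_i h_{i,j} ∑_{k > i} f_k` (`isNodeFamily_nodePoly`); in particular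
`f_j(1) = 0` for `j < N`.

*Optimal matrices* (`mem_optimalSet_iff`).  `H` is optimal if and only if `∑_j f_j` equals
`-(1 + X + ⋯ + X^(N-1)) / N` and all certificates are nonnegative.  Under the first condition,
summation by parts in `ℝ[X] ⊗ E` writes the performance of the algorithm as a square plus a
combination of the nonexpansiveness inequalities with weights `-⟨f_j, f_k⟩`
(`performance_identity`), so both conditions together suffice.  Conversely, the first condition
follows from running the algorithm on the negacyclic shift of `ℝ^N` from the all-ones vector
(`isInvariant_of_mem_optimalSet`).  To see that `⟨f_j, f_k⟩ ≤ 0`, compose this shift with a fold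
along a hyperplane which leaves the `k`-th iterate barely on the wrong side and passes close to all
others but the `j`-th: to first order only the inequality of the pair `(j, k)` becomes strict, and
the performance identity gives the sign (`ip_nonpos_of_mem_optimalSet`).

*Vertices.*  For optimal `H` the polynomials `f_k`, `k > j`, span the polynomials of degree less
than `N - j`, so a node `j` without an arc to a later node would have `f_j` proportional to
`X^(N-j)`, against `f_j(1) = 0` (`exists_isArc`).  Hence there are at least `N - 1` arcs, and the
vertices are the optimal matrices with exactly one arc per node (`isVertex_iff_isTree`), since a
matrix of this kind exists.  Such a matrix is determined by its tree (`eq_of_same_arcs`).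

*Gluings.*  Gluing keeps the polynomials of the right part, multiplies those of the left part by a
multiple of `X^(N-N')`, and inserts the polynomial which spans the orthogonal complement of the
polynomials of degree less than `N - N'` vanishing at `1`, within the polynomials of degree at most
`N - N'` vanishing at `1` (`IsBlockGluing.nodePoly_leftNode`, `nodePoly_mid_eq_iff`).  So arcs of the
two parts persist, and only the arc `(N, N')` is added (`IsGluing.hasArcs`).  Cutting a non-crossing
tree at the first child of the root shows that each such tree comes from a basic matrix
(`exists_isBasic_hasArcs`), and uniqueness finishes the proof.
-/

open Polynomial

namespace FixedPointAlg

/-! ### Node polynomials -/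

/-- The coefficientwise inner product on `ℝ[X]`, that is, the inner product of `L²` of the unit
circle. -/
noncomputable def ip : ℝ[X] →ₗ[ℝ] ℝ[X] →ₗ[ℝ] ℝ :=
  LinearMap.mk₂ ℝ (fun f g => f.sum fun d a => a * g.coeff d)
    (fun f f' g => by
      exact Polynomial.sum_add_index f f' (fun d a => a * g.coeff d) (by simp)
        (fun _ _ _ => add_mul _ _ _))
    (fun c f g => (Polynomial.sum_smul_index f c (fun d a => a * g.coeff d) (by simp)).trans
      (by simp [Polynomial.sum_def, Finset.mul_sum, mul_assoc]))
    (fun f g g' => by simp [Polynomial.sum_def, mul_add, Finset.sum_add_distrib])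
    (fun c f g => by
      simp only [Polynomial.sum_def, coeff_smul, smul_eq_mul, Finset.mul_sum]
      exact Finset.sum_congr rfl fun _ _ => by ring)

lemma ip_eq_sum_range {f : ℝ[X]} (g : ℝ[X]) {K : ℕ} (h : f.natDegree < K) :
    ip f g = ∑ d ∈ Finset.range K, f.coeff d * g.coeff d := by
  exact f.sum_over_range' (f := fun d a => a * g.coeff d) (fun d => by simp) K h

lemma ip_comm (f g : ℝ[X]) : ip f g = ip g f := by
  rw [ip_eq_sum_range (K := max f.natDegree g.natDegree + 1) g (by omega),
    ip_eq_sum_range (K := max f.natDegree g.natDegree + 1) f (by omega)]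
  exact Finset.sum_congr rfl fun _ _ => mul_comm _ _

lemma ip_X_pow (d : ℕ) (f : ℝ[X]) : ip (X ^ d) f = f.coeff d := by
  rw [ip_eq_sum_range (K := d + 1) f (by simp)]
  simp [coeff_X_pow]

lemma ip_X_pow_mul (d : ℕ) (f g : ℝ[X]) : ip (X ^ d * f) (X ^ d * g) = ip f g := by
  rw [ip_eq_sum_range (f := X ^ d * f) (K := d + (f.natDegree + 1)) _
      ((natDegree_mul_le).trans_lt (by simp)),
    ip_eq_sum_range (f := f) (K := f.natDegree + 1) _ (by omega), Finset.sum_range_add]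
  rw [Finset.sum_eq_zero, zero_add]
  · refine Finset.sum_congr rfl fun i _ => ?_
    rw [add_comm d i, coeff_X_pow_mul, coeff_X_pow_mul]
  · intro i hi
    rw [coeff_X_pow_mul', if_neg (by simpa using hi), zero_mul]

lemma ip_X_pow_mul_of_natDegree_lt {d : ℕ} (f : ℝ[X]) {g : ℝ[X]} (h : g.natDegree < d) :
    ip (X ^ d * f) g = 0 := by
  rw [ip_comm, ip_eq_sum_range _ h]
  refine Finset.sum_eq_zero fun i hi => ?_
  rw [coeff_X_pow_mul', if_neg (by simpa using hi), mul_zero]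

/-- The polynomial `1 + X + ⋯ + X ^ n`, which represents evaluation at `1` on polynomials of
degree at most `n`. -/
noncomputable def geomPoly (n : ℕ) : ℝ[X] := ∑ d ∈ Finset.range (n + 1), X ^ d

lemma ip_geomPoly {n : ℕ} {f : ℝ[X]} (h : f.natDegree ≤ n) : ip (geomPoly n) f = f.eval 1 := by
  rw [geomPoly, map_sum, LinearMap.sum_apply, eval_eq_sum_range' (Nat.lt_succ_of_le h)]
  simp [ip_X_pow]

lemma coeff_geomPoly (n d : ℕ) : (geomPoly n).coeff d = if d ≤ n then 1 else 0 := by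
  simp [geomPoly, coeff_X_pow]

lemma natDegree_geomPoly_le (n : ℕ) : (geomPoly n).natDegree ≤ n := by
  rw [natDegree_le_iff_coeff_eq_zero]
  intro d hd
  rw [coeff_geomPoly, if_neg (by omega)]

lemma ip_one_sub_X_pow (l m : ℕ) :
    ip ((1 - X) ^ l) ((1 - X) ^ m) = ((l + m).choose m : ℝ) := by
  have hc : ∀ k d : ℕ, ((1 - X : ℝ[X]) ^ k).coeff d = (-1) ^ d * (k.choose d : ℝ) := by
    intro k d
    have : (1 - X : ℝ[X]) ^ k = ((1 + X : ℝ[X]) ^ k).comp (C (-1) * X) := by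
      simp [sub_eq_add_neg]
    rw [this, comp_C_mul_X_coeff, coeff_one_add_X_pow]
    ring
  rw [ip_eq_sum_range (K := l + m + 1)]
  · rw [Nat.add_choose_eq, Finset.Nat.sum_antidiagonal_eq_sum_range_succ_mk]
    push_cast
    simp only [hc]
    rw [← Finset.sum_subset (s₁ := Finset.range (m + 1))]
    · refine Finset.sum_congr rfl fun i hi => ?_
      have hi' : i ≤ m := by simpa [Nat.lt_succ_iff] using hi
      rw [Nat.choose_symm hi', mul_mul_mul_comm, ← mul_pow]
      simp
    · intro x hx
      simp at hx ⊢
      omega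
    · intro x _ hx
      simp only [Finset.mem_range, not_lt] at hx
      rw [Nat.choose_eq_zero_of_lt (show m < x by omega)]
      simp
  · have : ((1 - X : ℝ[X]) ^ l).natDegree ≤ l * 1 := natDegree_pow_le_of_le l (by
      have := natDegree_sub_le (1 : ℝ[X]) X
      simpa using this)
    omega

/-- The polynomials `f_j` attached to the nodes of the diagram:
`f_j = ∑_m (-1)^(m-1) Q(m, j) (1 - X)^m` for a column `j`, and `f_N = -1` for the last node. -/
noncomputable def nodePoly {n : ℕ} (H : Matrix (Fin n) (Fin n) ℝ) : Fin (n + 1) → ℝ[X] :=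
  Fin.lastCases (-1)
    (fun j => ∑ m ∈ Finset.Icc 1 n, ((-1 : ℝ) ^ (m - 1) * Q H m j) • (1 - X) ^ m)

variable {n : ℕ}

lemma nodePoly_last (H : Matrix (Fin n) (Fin n) ℝ) : nodePoly H (Fin.last n) = -1 := by
  simp [nodePoly]

lemma nodePoly_castSucc (H : Matrix (Fin n) (Fin n) ℝ) (j : Fin n) :
    nodePoly H j.castSucc =
      ∑ m ∈ Finset.Icc 1 n, ((-1 : ℝ) ^ (m - 1) * Q H m j) • (1 - X) ^ m := by
  simp [nodePoly]

/-- The H-certificates are, up to a negative factor, the entries of the Gram matrix of the node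
polynomials; the binomial coefficients come from Vandermonde's identity. -/
lemma cert_eq_ip (H : Matrix (Fin n) (Fin n) ℝ) (k : Fin (n + 1)) (j : Fin n) :
    cert H k j = -((n : ℝ) + 1) * ip (nodePoly H j.castSucc) (nodePoly H k) := by
  induction k using Fin.lastCases with
  | last =>
    have h1 : ∀ m : ℕ, ip ((1 - X) ^ m) (1 : ℝ[X]) = 1 := fun m => by
      simpa using ip_one_sub_X_pow m 0
    rw [nodePoly_last, nodePoly_castSucc]
    simp [cert, h1]
    ring
  | cast k =>
    rw [nodePoly_castSucc, nodePoly_castSucc]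
    simp only [cert, Fin.lastCases_castSucc, map_sum, LinearMap.sum_apply, map_smul,
      LinearMap.smul_apply, ip_one_sub_X_pow, smul_eq_mul]
    rw [neg_mul, ← mul_neg, ← Finset.sum_neg_distrib]
    congr 1
    rw [Finset.sum_comm]
    refine Finset.sum_congr rfl fun l hl => ?_
    rw [Finset.mul_sum, ← Finset.sum_neg_distrib]
    refine Finset.sum_congr rfl fun m hm => ?_
    obtain ⟨l, rfl⟩ : ∃ a, l = a + 1 := ⟨l - 1, by simp at hl; omega⟩
    obtain ⟨m, rfl⟩ : ∃ a, m = a + 1 := ⟨m - 1, by simp at hm; omega⟩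
    have h : m + 1 + (l + 1) - 1 = m + l + 1 := by omega
    simp only [h, Nat.add_sub_cancel, pow_add]
    ring

lemma Q_eq_zero (H : Matrix (Fin n) (Fin n) ℝ) (m : ℕ) (j : Fin n) (h : n < m + j) :
    Q H m j = 0 := by
  induction m using Nat.strong_induction_on generalizing j with
  | _ m ih =>
    match m with
    | 0 => rfl
    | 1 => have := j.2; omega
    | m + 2 =>
      rw [Q]
      refine Finset.sum_eq_zero fun i hi => ?_
      rw [Finset.sum_eq_zero, mul_zero]
      intro j' hj'
      apply ih (m + 1) (by omega)
      simp only [Finset.mem_Ici, Finset.mem_Ioi, Fin.le_def, Fin.lt_def] at hi hj'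
      omega

/-- The sum of a family over the nodes after `i`. -/
noncomputable def tailSum (f : Fin (n + 1) → ℝ[X]) (i : Fin n) : ℝ[X] :=
  ∑ k ∈ Finset.Ioi i.castSucc, f k

lemma tailSum_eq_sum_ite (f : Fin (n + 1) → ℝ[X]) (i : Fin n) :
    tailSum f i = ∑ k, if i.castSucc < k then f k else 0 := by
  rw [tailSum, ← Finset.sum_filter]
  congr 1
  ext; simp

lemma tailSum_eq_succ (f : Fin (n + 1) → ℝ[X]) (i : Fin n) :
    tailSum f i = (∑ k ∈ Finset.Ioi i, f k.castSucc) + f (Fin.last n) := by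
  rw [tailSum_eq_sum_ite, Fin.sum_univ_castSucc, if_pos (Fin.castSucc_lt_last i)]
  simp only [Fin.castSucc_lt_castSucc_iff]
  rw [← Finset.sum_filter]
  congr 2
  ext; simp

/-- A family of polynomials on the nodes which satisfies the recursion that characterises the node
polynomials of `H`. -/
def IsNodeFamily (H : Matrix (Fin n) (Fin n) ℝ) (f : Fin (n + 1) → ℝ[X]) : Prop :=
  f (Fin.last n) = -1 ∧
    ∀ j : Fin n, f j.castSucc = (1 - X) * -∑ i, H i j • tailSum f i

lemma sum_eq_sum_Ici {M : Type*} [AddCommMonoid M] [Module ℝ M] {H : Matrix (Fin n) (Fin n) ℝ}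
    (hH : IsLowerTri H) (j : Fin n) (u : Fin n → M) :
    ∑ i, H i j • u i = ∑ i ∈ Finset.Ici j, H i j • u i := by
  refine (Finset.sum_subset (Finset.subset_univ _) fun i _ hi => ?_).symm
  rw [hH i j (by simpa using hi), zero_smul]

lemma isNodeFamily_nodePoly {H : Matrix (Fin n) (Fin n) ℝ} (hH : IsLowerTri H) :
    IsNodeFamily H (nodePoly H) := by
  refine ⟨nodePoly_last H, fun j => ?_⟩
  rw [sum_eq_sum_Ici hH]
  simp only [tailSum_eq_succ, nodePoly_last, nodePoly_castSucc]
  have hn : 0 < n := j.pos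
  obtain ⟨n, rfl⟩ : ∃ k, n = k + 1 := ⟨n - 1, by omega⟩
  have key : ∀ j : Fin (n + 1), ∑ m ∈ Finset.Icc 1 (n + 1),
      ((-1 : ℝ) ^ (m - 1) * Q H m j) • (1 - X : ℝ[X]) ^ m =
      ∑ m ∈ Finset.range (n + 1), ((-1 : ℝ) ^ m * Q H (m + 1) j) • (1 - X : ℝ[X]) ^ (m + 1) := by
    intro j
    refine (Finset.sum_nbij (· + 1) ?_ ?_ ?_ fun _ _ => rfl).symm
    · intro m hm
      simp at hm ⊢
      omega
    · intro m _ m' _ h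
      simpa using h
    · intro m hm
      simp only [Finset.coe_Icc, Set.mem_Icc] at hm
      exact ⟨m - 1, by simp; omega, by simp; omega⟩
  simp only [key]
  rw [Finset.sum_range_succ']
  simp only [Q, Finset.mul_sum, Finset.sum_smul, ← Finset.sum_neg_distrib]
  rw [Finset.sum_comm]
  rw [← Finset.sum_add_distrib]
  refine Finset.sum_congr rfl fun i hi => ?_
  have hlast : ∀ k ∈ Finset.Ioi i, ∑ m ∈ Finset.range (n + 1),
      ((-1 : ℝ) ^ m * Q H (m + 1) k) • (1 - X : ℝ[X]) ^ (m + 1) =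
      ∑ m ∈ Finset.range n, ((-1 : ℝ) ^ m * Q H (m + 1) k) • (1 - X : ℝ[X]) ^ (m + 1) := by
    intro k hk
    rw [Finset.sum_range_succ, Q_eq_zero H (n + 1) k]
    · simp
    · simp only [Finset.mem_Ioi, Fin.lt_def] at hk
      omega
  rw [Finset.sum_congr rfl hlast, Finset.sum_comm]
  rw [smul_add, Finset.smul_sum, neg_add, mul_add, ← Finset.sum_neg_distrib, Finset.mul_sum]
  congr 1
  · refine Finset.sum_congr rfl fun k _ => ?_
    rw [Finset.smul_sum, ← Finset.sum_neg_distrib, Finset.mul_sum]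
    refine Finset.sum_congr rfl fun m _ => ?_
    simp only [smul_eq_C_mul, map_mul, map_pow, map_neg, map_one]
    ring
  · simp only [smul_eq_C_mul, map_mul, map_pow, map_neg, map_one]
    ring

lemma downward_induction {P : Fin (n + 1) → Prop} (hlast : P (Fin.last n))
    (h : ∀ j : Fin n, (∀ k, j.castSucc < k → P k) → P j.castSucc) (k : Fin (n + 1)) : P k := by
  induction k using (wellFounded_gt (α := Fin (n + 1))).induction with
  | _ k ih =>
    induction k using Fin.lastCases with
    | last => exact hlast
    | cast j => exact h j ih

lemma IsNodeFamily.unique {H : Matrix (Fin n) (Fin n) ℝ} (hH : IsLowerTri H)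
    {f f' : Fin (n + 1) → ℝ[X]} (hf : IsNodeFamily H f) (hf' : IsNodeFamily H f') : f = f' := by
  funext k
  induction k using downward_induction with
  | hlast => rw [hf.1, hf'.1]
  | h j ih =>
    rw [hf.2, hf'.2, sum_eq_sum_Ici hH, sum_eq_sum_Ici hH]
    congr 2
    refine Finset.sum_congr rfl fun i hi => ?_
    congr 1
    refine Finset.sum_congr rfl fun k hk => ih k ?_
    exact (Fin.castSucc_le_castSucc_iff.2 (Finset.mem_Ici.1 hi)).trans_lt (Finset.mem_Ioi.1 hk)

lemma natDegree_tailSum_le {f : Fin (n + 1) → ℝ[X]} {i : Fin n}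
    (h : ∀ k, i.castSucc < k → (f k).natDegree ≤ n - k) :
    (tailSum f i).natDegree ≤ n - 1 - i := by
  refine natDegree_sum_le_of_forall_le _ _ fun k hk => ?_
  have hk' := Finset.mem_Ioi.1 hk
  refine (h k hk').trans ?_
  simp only [Fin.lt_def, Fin.val_castSucc] at hk'
  omega

lemma natDegree_nodePoly_le {H : Matrix (Fin n) (Fin n) ℝ} (hH : IsLowerTri H)
    (k : Fin (n + 1)) : (nodePoly H k).natDegree ≤ n - k := by
  induction k using downward_induction with
  | hlast => simp [nodePoly_last]
  | h j ih =>
    rw [(isNodeFamily_nodePoly hH).2, sum_eq_sum_Ici hH]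
    refine natDegree_mul_le.trans ?_
    have h1 : (1 - X : ℝ[X]).natDegree ≤ 1 := by
      simpa using natDegree_sub_le (1 : ℝ[X]) X
    have h2 : (-∑ i ∈ Finset.Ici j, H i j • tailSum (nodePoly H) i).natDegree ≤ n - 1 - j := by
      rw [natDegree_neg]
      refine natDegree_sum_le_of_forall_le _ _ fun i hi => ?_
      refine (natDegree_smul_le _ _).trans ((natDegree_tailSum_le fun k hk => ih k ?_).trans ?_)
      · exact (Fin.castSucc_le_castSucc_iff.2 (Finset.mem_Ici.1 hi)).trans_lt hk
      · have := Fin.le_def.1 (Finset.mem_Ici.1 hi)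
        omega
    have := j.2
    simp only [Fin.val_castSucc]
    omega

/-- The quotient of the node polynomial of column `j` by `1 - X`. -/
noncomputable def quotPoly (H : Matrix (Fin n) (Fin n) ℝ) (j : Fin n) : ℝ[X] :=
  -∑ i, H i j • tailSum (nodePoly H) i

lemma nodePoly_eq_mul_quotPoly {H : Matrix (Fin n) (Fin n) ℝ} (hH : IsLowerTri H) (j : Fin n) :
    nodePoly H j.castSucc = (1 - X) * quotPoly H j :=
  (isNodeFamily_nodePoly hH).2 j

lemma coeff_quotPoly {H : Matrix (Fin n) (Fin n) ℝ} (hH : IsLowerTri H) (j : Fin n) {d : ℕ}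
    (hd : n - 1 - j ≤ d) :
    (quotPoly H j).coeff d = -(H j j * (nodePoly H j.succ).coeff d) := by
  rw [quotPoly, sum_eq_sum_Ici hH, coeff_neg, finsetSum_coeff, Finset.sum_eq_single j]
  · rw [coeff_smul, tailSum, finsetSum_coeff, Finset.sum_eq_single j.succ]
    · rfl
    · intro k hk hkj
      apply coeff_eq_zero_of_natDegree_lt
      refine (natDegree_nodePoly_le hH k).trans_lt ?_
      simp only [Finset.mem_Ioi, Fin.lt_def, Fin.val_castSucc, ne_eq, Fin.ext_iff,
        Fin.val_succ] at hk hkj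
      omega
    · intro h
      exact absurd (Finset.mem_Ioi.2 (Fin.castSucc_lt_succ)) h
  · intro i hi hij
    rw [coeff_smul, coeff_eq_zero_of_natDegree_lt, smul_zero]
    refine (natDegree_tailSum_le fun k _ => natDegree_nodePoly_le hH k).trans_lt ?_
    simp only [Finset.mem_Ici, Fin.le_def, ne_eq, Fin.ext_iff] at hi hij
    omega
  · simp

lemma natDegree_quotPoly_le {H : Matrix (Fin n) (Fin n) ℝ} (hH : IsLowerTri H) (j : Fin n) :
    (quotPoly H j).natDegree ≤ n - 1 - j := by
  rw [natDegree_le_iff_coeff_eq_zero]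
  intro d hd
  rw [coeff_quotPoly hH j hd.le, coeff_eq_zero_of_natDegree_lt, mul_zero, neg_zero]
  refine (natDegree_nodePoly_le hH _).trans_lt ?_
  simp only [Fin.val_succ]
  omega

lemma coeff_nodePoly_castSucc {H : Matrix (Fin n) (Fin n) ℝ} (hH : IsLowerTri H) (j : Fin n) :
    (nodePoly H j.castSucc).coeff (n - j) = H j j * (nodePoly H j.succ).coeff (n - 1 - j) := by
  have hj := j.2
  have h : n - (j : ℕ) = n - 1 - j + 1 := by omega
  rw [nodePoly_eq_mul_quotPoly hH, h, sub_mul, one_mul, coeff_sub, coeff_X_mul,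
    coeff_eq_zero_of_natDegree_lt ((natDegree_quotPoly_le hH j).trans_lt (by omega)),
    coeff_quotPoly hH j le_rfl]
  ring

lemma eval_one_nodePoly {H : Matrix (Fin n) (Fin n) ℝ} (hH : IsLowerTri H) (j : Fin n) :
    (nodePoly H j.castSucc).eval 1 = 0 := by
  rw [nodePoly_eq_mul_quotPoly hH]
  simp

/-- The H-invariance condition `∑_j Q(m, j; H) = (N choose m+1) / N` for all `m`, written as an
identity between polynomials. -/
def IsInvariant (H : Matrix (Fin n) (Fin n) ℝ) : Prop :=
  ∑ k, nodePoly H k = -((1 / ((n : ℝ) + 1)) • geomPoly n)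

lemma coeff_nodePoly_ne_zero {H : Matrix (Fin n) (Fin n) ℝ} (hH : IsLowerTri H)
    (hI : IsInvariant H) (k : Fin (n + 1)) : (nodePoly H k).coeff (n - k) ≠ 0 := by
  induction k using Fin.induction with
  | zero =>
    have h := congrArg (fun q => q.coeff n) hI
    simp only [finsetSum_coeff, coeff_neg, coeff_smul, coeff_geomPoly] at h
    rw [Finset.sum_eq_single 0] at h
    · simp only [Fin.val_zero, Nat.sub_zero, h]
      have : (n : ℝ) + 1 ≠ 0 := by positivity
      simpa using this
    · intro k _ hk
      apply coeff_eq_zero_of_natDegree_lt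
      refine (natDegree_nodePoly_le hH k).trans_lt ?_
      have := Fin.pos_iff_ne_zero.2 hk
      simp only [Fin.lt_def, Fin.val_zero] at this
      omega
    · simp
  | succ j ih =>
    simp only [Fin.val_castSucc] at ih
    rw [coeff_nodePoly_castSucc hH] at ih
    have := right_ne_zero_of_mul ih
    have h : n - (j.succ : ℕ) = n - 1 - j := by
      simp only [Fin.val_succ]
      omega
    rwa [h]

lemma diag_ne_zero {H : Matrix (Fin n) (Fin n) ℝ} (hH : IsLowerTri H)
    (hI : IsInvariant H) (j : Fin n) : H j j ≠ 0 := by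
  have h := coeff_nodePoly_ne_zero hH hI j.castSucc
  simp only [Fin.val_castSucc] at h
  rw [coeff_nodePoly_castSucc hH] at h
  exact left_ne_zero_of_mul h

/-- The Gram matrix of the node polynomials has zero row sums, except in the last row. -/
lemma sum_ip_nodePoly {H : Matrix (Fin n) (Fin n) ℝ} (hH : IsLowerTri H)
    (hI : IsInvariant H) (j : Fin (n + 1)) :
    ∑ k, ip (nodePoly H j) (nodePoly H k) = if j = Fin.last n then 1 / ((n : ℝ) + 1) else 0 := by
  rw [← map_sum, hI, ip_comm, map_neg, map_smul, LinearMap.neg_apply, LinearMap.smul_apply,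
    ip_geomPoly ((natDegree_nodePoly_le hH j).trans (by omega))]
  induction j using Fin.lastCases with
  | last => simp [nodePoly_last]
  | cast j => simp [eval_one_nodePoly hH, (Fin.castSucc_lt_last j).ne]

/-! ### The energy identity -/

section Energy

variable {E : Type*} [AddCommGroup E] [Module ℝ E]

/-- `y` is produced from the residuals `g` by the step-size matrix `H`. -/
def IsIteration (H : Matrix (Fin n) (Fin n) ℝ) (g y : Fin (n + 1) → E) : Prop :=
  ∀ k : Fin n, y k.succ = y k.castSucc - ∑ j ∈ Finset.Iic k, H k j • g j.castSucc

lemma IsIteration.eq_sub {H : Matrix (Fin n) (Fin n) ℝ} (hH : IsLowerTri H)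
    {g y : Fin (n + 1) → E} (hy : IsIteration H g y) (k : Fin (n + 1)) :
    y k = y 0 - ∑ i : Fin n, if i.castSucc < k then ∑ j, H i j • g j.castSucc else 0 := by
  induction k using Fin.induction with
  | zero => simp
  | succ k ih =>
    have h1 : ∑ j ∈ Finset.Iic k, H k j • g j.castSucc = ∑ j, H k j • g j.castSucc := by
      refine Finset.sum_subset (Finset.subset_univ _) fun j _ hj => ?_
      rw [hH k j (by simpa using hj), zero_smul]
    have h2 : ∀ i : Fin n, (if i.castSucc < k.succ then ∑ j, H i j • g j.castSucc else 0) =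
        (if i.castSucc < k.castSucc then ∑ j, H i j • g j.castSucc else 0) +
          if i = k then ∑ j, H i j • g j.castSucc else 0 := by
      intro i
      rcases lt_trichotomy i k with h | h | h
      · rw [if_pos (Fin.castSucc_lt_succ_iff.2 h.le), if_pos (Fin.castSucc_lt_castSucc_iff.2 h),
          if_neg h.ne, add_zero]
      · simp [h]
      · have h3 : ¬ i < k := not_lt.2 h.le
        have h4 : ¬ i.castSucc < k.succ := by
          simp only [Fin.lt_def, Fin.val_castSucc, Fin.val_succ] at h ⊢
          omega
        simp [h3, h4, h.ne']
    rw [hy k, ih, h1, Finset.sum_congr rfl fun i _ => h2 i, Finset.sum_add_distrib]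
    simp
    abel

/-- Summation by parts along the iteration, in the tensor product of the polynomials with the
ambient space; `φ` tests this identity. -/
lemma IsIteration.sum_nodePoly {H : Matrix (Fin n) (Fin n) ℝ} (hH : IsLowerTri H)
    {g y : Fin (n + 1) → E} (hy : IsIteration H g y) (φ : ℝ[X] →ₗ[ℝ] E →ₗ[ℝ] E) :
    ∑ k, φ (nodePoly H k) (y k) =
      φ (∑ k, nodePoly H k) (y 0) + ∑ j, φ (quotPoly H j) (g j.castSucc) := by
  rw [Finset.sum_congr rfl fun k _ => by rw [hy.eq_sub hH k, map_sub, map_sum],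
    Finset.sum_sub_distrib, map_sum, LinearMap.sum_apply, sub_eq_add_neg]
  congr 1
  have h : ∀ k (i : Fin n), φ (nodePoly H k)
      (if i.castSucc < k then ∑ j, H i j • g j.castSucc else 0) =
      ∑ j, H i j • φ (if i.castSucc < k then nodePoly H k else 0) (g j.castSucc) := by
    intro k i
    split_ifs <;> simp
  simp only [h, quotPoly, map_neg, map_sum, LinearMap.neg_apply, LinearMap.sum_apply, map_smul,
    LinearMap.smul_apply, tailSum_eq_sum_ite, Finset.smul_sum]
  rw [Finset.sum_neg_distrib]
  congr 1
  exact Finset.sum_comm.trans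
    ((Finset.sum_congr rfl fun i _ => Finset.sum_comm).trans Finset.sum_comm)

end Energy

section Identity

variable {E : Type*} [NormedAddCommGroup E] [InnerProductSpace ℝ E]

local notation "⟪" x ", " y "⟫" => inner ℝ x y

lemma sum_ip_inner {H : Matrix (Fin n) (Fin n) ℝ} (hH : IsLowerTri H) (u v : Fin (n + 1) → E) :
    ∑ j, ∑ k, ip (nodePoly H j) (nodePoly H k) * ⟪u j, v k⟫ =
      ∑ d ∈ Finset.range (n + 1), ⟪∑ j, (nodePoly H j).coeff d • u j,
        ∑ k, (nodePoly H k).coeff d • v k⟫ := by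
  have h : ∀ j k, ip (nodePoly H j) (nodePoly H k) =
      ∑ d ∈ Finset.range (n + 1), (nodePoly H j).coeff d * (nodePoly H k).coeff d := fun j k =>
    ip_eq_sum_range _ ((natDegree_nodePoly_le hH j).trans_lt (by omega))
  simp only [h, sum_inner, inner_sum, real_inner_smul_left, real_inner_smul_right,
    Finset.sum_mul]
  refine (Finset.sum_congr rfl fun i _ => Finset.sum_comm).trans (Finset.sum_comm.trans ?_)
  refine Finset.sum_congr rfl fun d _ => Finset.sum_comm.trans ?_
  exact Finset.sum_congr rfl fun k _ => Finset.sum_congr rfl fun j _ => by ring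

/-- The quantity `⟪y j - y k, g j - g k⟫ - ‖g j - g k‖² / 2`, which nonexpansiveness of
`T = id - G` makes nonnegative. -/
noncomputable def slack (y g : Fin (n + 1) → E) (j k : Fin (n + 1)) : ℝ :=
  ⟪y j - y k, g j - g k⟫ - ‖g j - g k‖ ^ 2 / 2

/-- The weighted sum of all slacks. With `Y = ∑ quotPoly ⊗ g` and `G = ∑ nodePoly ⊗ g`, the vectors
`Y d - G d` are a shift of `Y` preceded by the last residual, so the sum telescopes. -/
lemma sum_ip_slack {H : Matrix (Fin n) (Fin n) ℝ} (hH : IsLowerTri H) (hI : IsInvariant H)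
    {g y : Fin (n + 1) → E} (hy : IsIteration H g y) :
    ((n : ℝ) + 1) * ∑ j, ∑ k, ip (nodePoly H j) (nodePoly H k) * slack y g j k =
      2 * ⟪y (Fin.last n) - y 0, g (Fin.last n)⟫ + n * ‖g (Fin.last n)‖ ^ 2 := by
  have hN : (n : ℝ) + 1 ≠ 0 := by positivity
  set f := nodePoly H with hf
  set gN := g (Fin.last n) with hgN
  -- the coefficients in `E` of the tensors `∑ quotPoly ⊗ g`, `∑ nodePoly ⊗ g`, `∑ nodePoly ⊗ y`
  set Y : ℕ → E := fun d => ∑ j, (quotPoly H j).coeff d • g j.castSucc with hY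
  set G : ℕ → E := fun d => ∑ k, (f k).coeff d • g k with hG
  set Z : ℕ → E := fun d => ∑ k, (f k).coeff d • y k with hZ
  have hZY : ∀ d ∈ Finset.range (n + 1), Z d = Y d - (1 / ((n : ℝ) + 1)) • y 0 := by
    intro d hd
    have h := hy.sum_nodePoly hH ((LinearMap.lsmul ℝ E).comp (lcoeff ℝ d))
    simp only [LinearMap.comp_apply, LinearMap.lsmul_apply, lcoeff_apply] at h
    simp only [hZ, hY]
    rw [h, hI]
    have hd' : d ≤ n := by simpa [Nat.lt_succ_iff] using hd
    simp [coeff_geomPoly, hd']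
    abel
  have hG0 : G 0 = Y 0 - gN := by
    simp only [hG, hY]
    rw [Fin.sum_univ_castSucc]
    simp [hf, nodePoly_eq_mul_quotPoly hH, nodePoly_last, sub_eq_add_neg, mul_coeff_zero, hgN]
  have hGs : ∀ d, G (d + 1) = Y (d + 1) - Y d := by
    intro d
    simp only [hG, hY]
    rw [Fin.sum_univ_castSucc]
    simp [hf, nodePoly_eq_mul_quotPoly hH, nodePoly_last, sub_mul, sub_smul, coeff_one]
  have hYn : Y n = 0 := by
    refine Finset.sum_eq_zero fun j _ => ?_
    rw [coeff_eq_zero_of_natDegree_lt, zero_smul]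
    refine (natDegree_quotPoly_le hH j).trans_lt ?_
    have := j.2
    omega
  have hsumG : ∑ d ∈ Finset.range (n + 1), G d = -gN := by
    rw [Finset.sum_range_succ']
    simp only [hGs, hG0]
    rw [Finset.sum_range_sub, hYn]
    abel
  have hsq : ∑ d ∈ Finset.range (n + 1), (⟪Y d, G d⟫ - ‖G d‖ ^ 2 / 2) = -‖gN‖ ^ 2 / 2 := by
    have h : ∀ d, ⟪Y d, G d⟫ - ‖G d‖ ^ 2 / 2 = ‖Y d‖ ^ 2 / 2 - ‖Y d - G d‖ ^ 2 / 2 := by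
      intro d
      rw [norm_sub_sq_real]
      ring
    simp only [h]
    rw [Finset.sum_sub_distrib, Finset.sum_range_succ, Finset.sum_range_succ' _ n]
    simp [hGs, hG0, hYn]
    ring
  have hmain : ∑ j, ∑ k, ip (f j) (f k) * (⟪y j, g k⟫ - ⟪g j, g k⟫ / 2) =
      -‖gN‖ ^ 2 / 2 + (1 / ((n : ℝ) + 1)) * ⟪y 0, gN⟫ := by
    have h1 := sum_ip_inner hH y g
    have h2 := sum_ip_inner hH g g
    have h3 : ∑ j, ∑ k, ip (f j) (f k) * (⟪y j, g k⟫ - ⟪g j, g k⟫ / 2) =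
        (∑ d ∈ Finset.range (n + 1), ⟪Z d, G d⟫) -
          (∑ d ∈ Finset.range (n + 1), ⟪G d, G d⟫) / 2 := by
      rw [← h1, ← h2]
      simp only [mul_sub, Finset.sum_sub_distrib, Finset.sum_div, mul_div_assoc, hf]
    rw [h3, Finset.sum_congr rfl fun d hd => by rw [hZY d hd], Finset.sum_div,
      ← Finset.sum_sub_distrib, ← hsq]
    simp only [inner_sub_left, inner_smul_left, real_inner_self_eq_norm_sq]
    simp only [sub_right_comm _ _ (‖_‖ ^ 2 / 2)]
    rw [Finset.sum_sub_distrib]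
    simp
    rw [← Finset.mul_sum, ← inner_sum, hsumG, inner_neg_right]
    ring
  have hrow := sum_ip_nodePoly hH hI
  have hexp : ∀ j k, ip (f j) (f k) * slack y g j k =
      ip (f j) (f k) * (⟪y j, g j⟫ - ‖g j‖ ^ 2 / 2) + ip (f k) (f j) * (⟪y k, g k⟫ - ‖g k‖ ^ 2 / 2)
      - (ip (f j) (f k) * (⟪y j, g k⟫ - ⟪g j, g k⟫ / 2)
        + ip (f k) (f j) * (⟪y k, g j⟫ - ⟪g k, g j⟫ / 2)) := by
    intro j k
    rw [slack, norm_sub_sq_real, inner_sub_left, inner_sub_right, inner_sub_right,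
      ip_comm (f k) (f j), real_inner_comm (g j) (g k)]
    ring
  have hrow' : ∀ c : Fin (n + 1) → ℝ, ∑ j, ∑ k, ip (f j) (f k) * c j =
      (1 / ((n : ℝ) + 1)) * c (Fin.last n) := by
    intro c
    simp only [← Finset.sum_mul, hrow, hf]
    simp
  simp only [hexp, Finset.sum_add_distrib, Finset.sum_sub_distrib]
  rw [Finset.sum_comm (f := fun j k => ip (f k) (f j) * (⟪y k, g k⟫ - ‖g k‖ ^ 2 / 2)),
    Finset.sum_comm (f := fun j k => ip (f k) (f j) * (⟪y k, g j⟫ - ⟪g k, g j⟫ / 2)), hrow',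
    hmain, inner_sub_left]
  field_simp
  ring

lemma slack_self (y g : Fin (n + 1) → E) (j : Fin (n + 1)) : slack y g j j = 0 := by
  simp [slack]

/-- The performance of an invariant step-size matrix, as a square plus a combination of the slacks
of the nonexpansiveness inequalities whose weights are the H-certificates. -/
lemma performance_identity {H : Matrix (Fin n) (Fin n) ℝ} (hH : IsLowerTri H)
    (hI : IsInvariant H) {g y : Fin (n + 1) → E} (hy : IsIteration H g y) (z : E) :
    ‖y 0 - z‖ ^ 2 - ((n : ℝ) + 1) ^ 2 / 4 * ‖g (Fin.last n)‖ ^ 2 =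
      ‖y 0 - z - (((n : ℝ) + 1) / 2) • g (Fin.last n)‖ ^ 2 +
      ((n : ℝ) + 1) *
        (⟪y (Fin.last n) - z, g (Fin.last n)⟫ - ‖g (Fin.last n)‖ ^ 2 / 2) -
      ((n : ℝ) + 1) ^ 2 / 2 *
        ∑ j, ∑ k, ip (nodePoly H j) (nodePoly H k) * slack y g j k := by
  have h := sum_ip_slack hH hI hy
  have h1 : y (Fin.last n) - y 0 = (y (Fin.last n) - z) - (y 0 - z) := by abel
  rw [h1, inner_sub_left] at h
  have h2 : ((n : ℝ) + 1) ^ 2 / 2 *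
      ∑ j, ∑ k, ip (nodePoly H j) (nodePoly H k) * slack y g j k = ((n : ℝ) + 1) / 2 *
      (((n : ℝ) + 1) * ∑ j, ∑ k, ip (nodePoly H j) (nodePoly H k) * slack y g j k) := by
    ring
  rw [h2, h, norm_sub_sq_real (y 0 - z), norm_smul, real_inner_smul_right, mul_pow, Real.norm_eq_abs, sq_abs]
  ring

end Identity

lemma inner_sub_half_sq_nonneg {E : Type*} [NormedAddCommGroup E] [InnerProductSpace ℝ E]
    {u v : E} (h : ‖u - v‖ ≤ ‖u‖) : 0 ≤ inner ℝ u v - ‖v‖ ^ 2 / 2 := by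
  have h1 : ‖u - v‖ ^ 2 ≤ ‖u‖ ^ 2 := by gcongr
  rw [norm_sub_sq_real] at h1
  linarith

/-- All H-certificates are nonnegative. -/
def IsCertified (H : Matrix (Fin n) (Fin n) ℝ) : Prop :=
  ∀ (j : Fin n) (k : Fin (n + 1)), j.castSucc < k → 0 ≤ cert H k j

lemma IsCertified.ip_nonpos {H : Matrix (Fin n) (Fin n) ℝ} (hC : IsCertified H)
    {j k : Fin (n + 1)} (h : j < k) : ip (nodePoly H j) (nodePoly H k) ≤ 0 := by
  induction j using Fin.lastCases with
  | last => exact absurd h (not_lt.2 (Fin.le_last k))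
  | cast j =>
    have h1 := hC j k h
    rw [cert_eq_ip] at h1
    have h2 : (0 : ℝ) < (n : ℝ) + 1 := by positivity
    by_contra! h3
    nlinarith [mul_pos h2 h3]

theorem mem_optimalSet_of_isCertified {H : Matrix (Fin n) (Fin n) ℝ} (hH : IsLowerTri H)
    (hI : IsInvariant H) (hC : IsCertified H) : H ∈ optimalSet n := by
  refine ⟨hH, fun X _ _ _ T hT z hz y hy => ?_⟩
  have hN : (0 : ℝ) < (n : ℝ) + 1 := by positivity
  have hT' : ∀ u v, ‖T u - T v‖ ≤ ‖u - v‖ := fun u v => by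
    simpa [dist_eq_norm] using hT.dist_le_mul u v
  have hid := performance_identity (g := fun k => y k - T (y k)) hH hI hy z
  have h1 : 0 ≤ inner ℝ (y (Fin.last n) - z) (y (Fin.last n) - T (y (Fin.last n))) -
      ‖y (Fin.last n) - T (y (Fin.last n))‖ ^ 2 / 2 := by
    apply inner_sub_half_sq_nonneg
    have := hT' (y (Fin.last n)) z
    rw [hz] at this
    refine le_trans (le_of_eq ?_) this
    congr 1
    abel
  have hs : ∀ j k, 0 ≤ slack y (fun k => y k - T (y k)) j k := by
    intro j k
    apply inner_sub_half_sq_nonneg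
    refine le_trans (le_of_eq (congrArg norm ?_)) (hT' (y j) (y k))
    change y j - y k - ((y j - T (y j)) - (y k - T (y k))) = _
    abel
  have h2 : ∑ j, ∑ k, ip (nodePoly H j) (nodePoly H k) *
      slack y (fun k => y k - T (y k)) j k ≤ 0 := by
    refine Finset.sum_nonpos fun j _ => Finset.sum_nonpos fun k _ => ?_
    rcases lt_trichotomy j k with h | h | h
    · exact mul_nonpos_of_nonpos_of_nonneg (hC.ip_nonpos h) (hs j k)
    · rw [h, slack_self, mul_zero]
    · rw [ip_comm]
      exact mul_nonpos_of_nonpos_of_nonneg (hC.ip_nonpos h) (hs j k)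
  rw [le_div_iff₀ (by positivity)]
  have h3 := mul_nonneg hN.le h1
  have h4 := mul_nonpos_of_nonneg_of_nonpos (show 0 ≤ ((n : ℝ) + 1) ^ 2 / 2 by positivity) h2
  have h5 := sq_nonneg ‖y 0 - z - (((n : ℝ) + 1) / 2) • (y (Fin.last n) - T (y (Fin.last n)))‖
  nlinarith

/-! ### Invariance of optimal step-size matrices -/

/-- The iteration exists for residual maps `R k` which may depend on the node. -/
lemma exists_iteration {E : Type*} [AddCommGroup E] [Module ℝ E] (H : Matrix (Fin n) (Fin n) ℝ)
    (R : Fin (n + 1) → E → E) (x : E) :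
    ∃ y : Fin (n + 1) → E, y 0 = x ∧ IsIteration H (fun k => R k (y k)) y := by
  suffices h : ∀ m : ℕ, ∃ y : Fin (n + 1) → E, y 0 = x ∧ ∀ k : Fin n, (k : ℕ) < m →
      y k.succ = y k.castSucc - ∑ j ∈ Finset.Iic k, H k j • R j.castSucc (y j.castSucc) by
    obtain ⟨y, h0, hy⟩ := h n
    exact ⟨y, h0, fun k => hy k k.2⟩
  intro m
  induction m with
  | zero => exact ⟨fun _ => x, rfl, fun k hk => absurd hk (Nat.not_lt_zero _)⟩
  | succ m ih =>
    obtain ⟨y, h0, hy⟩ := ih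
    by_cases hm : m < n
    · set a : Fin n := ⟨m, hm⟩ with ha
      refine ⟨Function.update y a.succ (y a.castSucc -
        ∑ j ∈ Finset.Iic a, H a j • R j.castSucc (y j.castSucc)), ?_, fun k hk => ?_⟩
      · rw [Function.update_of_ne (Fin.succ_ne_zero a).symm, h0]
      · have hne : ∀ j : Fin n, j ≤ k → j.castSucc ≠ a.succ := by
          intro j hj h
          simp only [Fin.le_def, Fin.ext_iff, Fin.val_castSucc, Fin.val_succ, ha] at hj h
          omega
        rw [Function.update_of_ne (hne k le_rfl)]
        have hs : ∑ j ∈ Finset.Iic k, H k j • R j.castSucc (Function.update y a.succ (y a.castSucc -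
            ∑ j ∈ Finset.Iic a, H a j • R j.castSucc (y j.castSucc)) j.castSucc) =
            ∑ j ∈ Finset.Iic k, H k j • R j.castSucc (y j.castSucc) :=
          Finset.sum_congr rfl fun j hj => by
            rw [Function.update_of_ne (hne j (Finset.mem_Iic.1 hj))]
        rw [hs]
        by_cases hka : k = a
        · subst hka
          rw [Function.update_self]
        · rw [Function.update_of_ne fun h => hka (Fin.succ_injective _ h), hy]
          have : (k : ℕ) ≠ m := fun h => hka (Fin.ext h)
          omega
    · exact ⟨y, h0, fun k _ => hy k (by omega)⟩

/-- The negacyclic shift `(x_0, …, x_n) ↦ (-x_n, x_0, …, x_{n-1})`. -/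
noncomputable def shift (n : ℕ) :
    EuclideanSpace ℝ (Fin (n + 1)) →ₗᵢ[ℝ] EuclideanSpace ℝ (Fin (n + 1)) where
  toFun x := WithLp.toLp 2 (Fin.cons (-x (Fin.last n)) fun i : Fin n => x i.castSucc)
  map_add' x y := by
    ext i
    refine Fin.cases ?_ (fun i => ?_) i <;> simp
    ring
  map_smul' c x := by
    ext i
    refine Fin.cases ?_ (fun i => ?_) i <;> simp
  norm_map' x := by
    simp only [EuclideanSpace.norm_eq]
    congr 1
    rw [Fin.sum_univ_succ, Fin.sum_univ_castSucc]
    simp [add_comm]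

lemma shift_zero (x : EuclideanSpace ℝ (Fin (n + 1))) : shift n x 0 = -x (Fin.last n) := rfl

lemma shift_succ (x : EuclideanSpace ℝ (Fin (n + 1))) (i : Fin n) :
    shift n x i.succ = x i.castSucc := rfl

/-- The all-ones vector. -/
noncomputable def ones (n : ℕ) : EuclideanSpace ℝ (Fin (n + 1)) := WithLp.toLp 2 fun _ => 1

lemma ones_sub_shift : ones n - shift n (ones n) = (2 : ℝ) • EuclideanSpace.single 0 1 := by
  ext i
  refine Fin.cases ?_ (fun i => ?_) i
  · simp [shift_zero, ones]
    norm_num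
  · simp [shift_succ, ones]

lemma shift_pow_single (d : ℕ) (hd : d < n + 1) :
    ((shift n).toLinearMap ^ d) (EuclideanSpace.single 0 1) = EuclideanSpace.single ⟨d, hd⟩ 1 := by
  induction d with
  | zero => rfl
  | succ d ih =>
    rw [pow_succ', Module.End.mul_apply, ih (by omega)]
    ext i
    refine Fin.cases ?_ (fun i => ?_) i
    · rw [LinearIsometry.coe_toLinearMap, shift_zero]
      have h1 : Fin.last n ≠ ⟨d, by omega⟩ := fun h => by
        have := congrArg Fin.val h
        simp at this
        omega
      have h2 : (0 : Fin (n + 1)) ≠ ⟨d + 1, hd⟩ := fun h => by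
        have := congrArg Fin.val h
        simp at this
      simp [h1, h2]
    · rw [LinearIsometry.coe_toLinearMap, shift_succ]
      simp [Fin.ext_iff]

lemma aeval_shift_single {p : ℝ[X]} (hp : p.natDegree ≤ n) (i : Fin (n + 1)) :
    (aeval (shift n).toLinearMap p) (EuclideanSpace.single 0 1) i = p.coeff i := by
  rw [aeval_eq_sum_range' (Nat.lt_succ_of_le hp), LinearMap.sum_apply, Finset.sum_range]
  simp only [LinearMap.smul_apply, shift_pow_single _ (Fin.is_lt _)]
  simp [Pi.single_apply]

/-- The trajectory of a linear operator `S` is obtained by applying a polynomial in `S` to the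
starting point. -/
lemma IsIteration.last_eq_aeval {E : Type*} [AddCommGroup E] [Module ℝ E]
    {H : Matrix (Fin n) (Fin n) ℝ} (hH : IsLowerTri H) (S : E →ₗ[ℝ] E) {y : Fin (n + 1) → E}
    (hy : IsIteration H (fun k => y k - S (y k)) y) :
    y (Fin.last n) = aeval S (-∑ k, nodePoly H k) (y 0) := by
  have h := hy.sum_nodePoly hH (aeval S).toLinearMap
  rw [Fin.sum_univ_castSucc, nodePoly_last] at h
  simp only [AlgHom.toLinearMap_apply, nodePoly_eq_mul_quotPoly hH] at h
  have h1 : ∀ j : Fin n, aeval S ((1 - X) * quotPoly H j) (y j.castSucc) =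
      aeval S (quotPoly H j) (y j.castSucc - S (y j.castSucc)) := by
    intro j
    rw [mul_comm, map_mul, Module.End.mul_apply]
    simp
  simp only [h1] at h
  rw [add_comm] at h
  have h2 := add_right_cancel h
  simp only [map_neg, map_one, LinearMap.neg_apply, Module.End.one_apply] at h2 ⊢
  rw [← h2, neg_neg]

lemma last_residual_shift {H : Matrix (Fin n) (Fin n) ℝ} (hH : IsLowerTri H)
    {y : Fin (n + 1) → EuclideanSpace ℝ (Fin (n + 1))} (h0 : y 0 = ones n)
    (hy : IsIteration H (fun k => y k - shift n (y k)) y) (i : Fin (n + 1)) :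
    (y (Fin.last n) - shift n (y (Fin.last n))) i = 2 * (-∑ k, nodePoly H k).coeff i := by
  have h := IsIteration.last_eq_aeval hH (shift n).toLinearMap hy
  set p := -∑ k, nodePoly H k with hp
  have hcomm : shift n (y (Fin.last n)) = aeval (shift n).toLinearMap p (shift n (y 0)) := by
    have h1 : aeval (shift n).toLinearMap (X * p) = aeval (shift n).toLinearMap (p * X) := by
      rw [mul_comm]
    have h2 := LinearMap.congr_fun h1 (y 0)
    rw [map_mul, map_mul, Module.End.mul_apply, Module.End.mul_apply, ← h, aeval_X] at h2
    exact h2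
  rw [hcomm, h, ← map_sub, h0, ones_sub_shift, map_smul, PiLp.smul_apply, aeval_shift_single,
    smul_eq_mul]
  rw [hp, natDegree_neg]
  exact natDegree_sum_le_of_forall_le _ _ fun k _ =>
    (natDegree_nodePoly_le hH k).trans (by omega)

lemma norm_ones_sq : ‖ones n‖ ^ 2 = (n : ℝ) + 1 := by
  rw [EuclideanSpace.norm_sq_eq]
  simp [ones]

/-- Running an optimal algorithm on the negacyclic shift from the all-ones vector forces the
coefficients of `-∑ f_j`, which sum to `1`, to have a sum of squares of at most `1 / N`. -/
theorem isInvariant_of_mem_optimalSet {H : Matrix (Fin n) (Fin n) ℝ} (hH : H ∈ optimalSet n) :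
    IsInvariant H := by
  obtain ⟨hL, hopt⟩ := hH
  obtain ⟨y, h0, hy⟩ := exists_iteration H (fun _ x => x - shift n x) (ones n)
  have hN : (0 : ℝ) < (n : ℝ) + 1 := by positivity
  have h := hopt _ (shift n) (shift n).lipschitz 0 (map_zero _) y hy
  rw [h0, sub_zero, norm_ones_sq, EuclideanSpace.norm_sq_eq] at h
  simp only [last_residual_shift hL h0 hy] at h
  set p := -∑ k, nodePoly H k with hp
  have hdeg : p.natDegree ≤ n := by
    rw [hp, natDegree_neg]
    exact natDegree_sum_le_of_forall_le _ _ fun k _ =>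
      (natDegree_nodePoly_le hL k).trans (by omega)
  have hsum : ∑ i : Fin (n + 1), p.coeff i = 1 := by
    have h1 : p.eval 1 = 1 := by
      rw [hp, Fin.sum_univ_castSucc, eval_neg, eval_add, eval_finsetSum, nodePoly_last]
      simp [eval_one_nodePoly hL]
    rw [← h1, eval_eq_sum_range' (Nat.lt_succ_of_le hdeg), Finset.sum_range]
    simp
  have hsq : ∑ i : Fin (n + 1), (p.coeff i - 1 / ((n : ℝ) + 1)) ^ 2 ≤ 0 := by
    have h1 : ∑ i : Fin (n + 1), p.coeff i ^ 2 ≤ 1 / ((n : ℝ) + 1) := by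
      have h2 : ∑ i : Fin (n + 1), ‖2 * p.coeff i‖ ^ 2 = 4 * ∑ i : Fin (n + 1), p.coeff i ^ 2 := by
        rw [Finset.mul_sum]
        refine Finset.sum_congr rfl fun i _ => ?_
        rw [Real.norm_eq_abs, sq_abs]
        ring
      rw [h2] at h
      have h3 : 4 * ((n : ℝ) + 1) / ((n : ℝ) + 1) ^ 2 = 4 * (1 / ((n : ℝ) + 1)) := by
        field_simp
      rw [h3] at h
      linarith
    have h2 : ∑ i : Fin (n + 1), (p.coeff i - 1 / ((n : ℝ) + 1)) ^ 2 =
        ∑ i : Fin (n + 1), p.coeff i ^ 2 -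
          2 * (1 / ((n : ℝ) + 1)) * ∑ i : Fin (n + 1), p.coeff i + 1 / ((n : ℝ) + 1) := by
      simp only [sub_sq, Finset.sum_add_distrib, Finset.sum_sub_distrib, Finset.mul_sum]
      congr 1
      · congr 1
        exact Finset.sum_congr rfl fun _ _ => by ring
      · simp
        field_simp
    rw [h2, hsum]
    linarith
  have hcoef : ∀ i : Fin (n + 1), p.coeff i = 1 / ((n : ℝ) + 1) := by
    intro i
    have h1 := (Finset.sum_eq_zero_iff_of_nonneg fun (i : Fin (n + 1)) _ =>
      sq_nonneg (p.coeff i - 1 / ((n : ℝ) + 1))).1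
      (le_antisymm hsq (Finset.sum_nonneg fun _ _ => sq_nonneg _)) i (Finset.mem_univ _)
    have := pow_eq_zero_iff (two_ne_zero) |>.1 h1
    linarith
  rw [IsInvariant, ← neg_eq_iff_eq_neg, ← hp]
  ext d
  rw [coeff_smul, coeff_geomPoly]
  split_ifs with hd
  · simpa using hcoef ⟨d, by omega⟩
  · rw [coeff_eq_zero_of_natDegree_lt (by omega)]
    simp

/-! ### Nonnegativity of the certificates of optimal step-size matrices -/

/-- The residuals of the trajectory on the negacyclic shift form a triangular matrix with nonzero
diagonal. -/
lemma residual_shift_triangular {H : Matrix (Fin n) (Fin n) ℝ}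
    (hd : ∀ j, H j j ≠ 0) {y : Fin (n + 1) → EuclideanSpace ℝ (Fin (n + 1))} (h0 : y 0 = ones n)
    (hy : IsIteration H (fun k => y k - shift n (y k)) y) (k : Fin (n + 1)) :
    (∀ d, k < d → (y k - shift n (y k)) d = 0) ∧ (y k - shift n (y k)) k ≠ 0 := by
  set g : Fin (n + 1) → EuclideanSpace ℝ (Fin (n + 1)) := fun k => y k - shift n (y k) with hg
  have hrec : ∀ k : Fin n, g k.succ =
      g k.castSucc - ∑ j ∈ Finset.Iic k, H k j • (g j.castSucc - shift n (g j.castSucc)) := by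
    intro k
    change y k.succ - shift n (y k.succ) = (y k.castSucc - shift n (y k.castSucc)) - _
    rw [hy k]
    simp only [smul_sub, Finset.sum_sub_distrib, map_sub, map_sum, map_smul]
    abel
  have hg0 : g 0 = (2 : ℝ) • EuclideanSpace.single 0 1 := by
    simp only [hg]
    rw [h0, ones_sub_shift]
  change (∀ d, k < d → g k d = 0) ∧ g k k ≠ 0
  induction k using (wellFounded_lt (α := Fin (n + 1))).induction with
  | _ k ih =>
    induction k using Fin.cases with
    | zero =>
      rw [hg0]
      refine ⟨fun d hd => ?_, by simp⟩
      simp [hd.ne']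
    | succ k =>
      have hlt : ∀ j ∈ Finset.Iic k, j.castSucc < k.succ := fun j hj =>
        Fin.castSucc_lt_succ_iff.2 (Finset.mem_Iic.1 hj)
      rw [hrec]
      constructor
      · intro d hd
        obtain ⟨e, rfl⟩ : ∃ e : Fin n, d = e.succ := Fin.exists_succ_eq.2
          (Fin.ne_zero_of_lt hd) |>.imp fun _ h => h.symm
        have hke : k < e := Fin.succ_lt_succ_iff.1 hd
        rw [PiLp.sub_apply, (ih _ (hlt k (by simp))).1 _ (Fin.castSucc_lt_succ_iff.2 hke.le),
          WithLp.ofLp_sum, Finset.sum_apply, Finset.sum_eq_zero, sub_zero]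
        intro j hj
        have hje := (Finset.mem_Iic.1 hj).trans_lt hke
        rw [PiLp.smul_apply, PiLp.sub_apply, shift_succ, (ih _ (hlt j hj)).1 _
          (Fin.castSucc_lt_succ_iff.2 hje.le), (ih _ (hlt j hj)).1 _
          (Fin.castSucc_lt_castSucc_iff.2 hje)]
        simp
      · rw [PiLp.sub_apply, (ih _ (hlt k (by simp))).1 _ Fin.castSucc_lt_succ,
          WithLp.ofLp_sum, Finset.sum_apply, Finset.sum_eq_single k]
        · rw [PiLp.smul_apply, PiLp.sub_apply, shift_succ,
            (ih _ (hlt k (by simp))).1 _ Fin.castSucc_lt_succ]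
          have := (ih _ (hlt k (by simp))).2
          simpa using ⟨hd k, this⟩
        · intro j hj hjk
          have hje := lt_of_le_of_ne (Finset.mem_Iic.1 hj) hjk
          rw [PiLp.smul_apply, PiLp.sub_apply, shift_succ, (ih _ (hlt j hj)).1 _
            (Fin.castSucc_lt_succ_iff.2 hje.le), (ih _ (hlt j hj)).1 _
            (Fin.castSucc_lt_castSucc_iff.2 hje)]
          simp
        · simp

/-- The points of the trajectory on the negacyclic shift are linearly independent: inner products
with them can be prescribed. -/
lemma exists_inner_eq {H : Matrix (Fin n) (Fin n) ℝ}
    (hd : ∀ j, H j j ≠ 0) {y : Fin (n + 1) → EuclideanSpace ℝ (Fin (n + 1))} (h0 : y 0 = ones n)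
    (hy : IsIteration H (fun k => y k - shift n (y k)) y) (v : Fin (n + 1) → ℝ) :
    ∃ m : EuclideanSpace ℝ (Fin (n + 1)), ∀ k, inner ℝ m (y k) = v k := by
  have htri := residual_shift_triangular hd h0 hy
  set A : Matrix (Fin (n + 1)) (Fin (n + 1)) ℝ :=
    Matrix.of fun k d => (y k - shift n (y k)) d with hA
  have hdet : IsUnit A.det := by
    rw [Matrix.det_of_isLowerTriangular A fun k d hkd => (htri k).1 d hkd]
    exact (Finset.prod_ne_zero_iff.2 fun k _ => (htri k).2).isUnit
  obtain ⟨m, hm⟩ := (Matrix.mulVec_surjective_iff_isUnit.2 ((Matrix.isUnit_iff_isUnit_det A).2 hdet)) v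
  set m' : EuclideanSpace ℝ (Fin (n + 1)) := WithLp.toLp 2 m
  refine ⟨m' - LinearMap.adjoint (shift n).toLinearMap m', fun k => ?_⟩
  rw [inner_sub_left, LinearMap.adjoint_inner_left, LinearIsometry.coe_toLinearMap,
    ← inner_sub_right, ← congrFun hm k]
  rw [PiLp.inner_apply]
  rfl

/-- The response of the trajectory of a linear operator to a disturbance `e` of a single residual
is bounded by a multiple of `‖e‖`. -/
lemma exists_response {E : Type*} [NormedAddCommGroup E] [NormedSpace ℝ E]
    (H : Matrix (Fin n) (Fin n) ℝ) (S : E →ₗᵢ[ℝ] E) (k₀ : Fin (n + 1)) :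
    ∃ C : ℝ, 0 ≤ C ∧ ∀ e : E, ∃ δ : Fin (n + 1) → E, δ 0 = 0 ∧
      IsIteration H (fun k => δ k - S (δ k) + if k = k₀ then e else 0) δ ∧
      (∀ k, ‖δ k‖ ≤ C * ‖e‖) ∧ ∀ k ≤ k₀, δ k = 0 := by
  have hbound : ∀ i : Fin (n + 1), ∃ C : ℝ, 0 ≤ C ∧ ∀ (e : E) (δ : Fin (n + 1) → E), δ 0 = 0 →
      IsIteration H (fun k => δ k - S (δ k) + if k = k₀ then e else 0) δ →
      ∀ k ≤ i, ‖δ k‖ ≤ C * ‖e‖ := by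
    intro i
    induction i using Fin.induction with
    | zero =>
      refine ⟨0, le_rfl, fun e δ h0 _ k hk => ?_⟩
      rw [Fin.le_zero_iff.1 hk, h0]
      simp
    | succ i ih =>
      obtain ⟨C, hC, h⟩ := ih
      have hC' : 0 ≤ ∑ j ∈ Finset.Iic i, |H i j| * (2 * C + 1) :=
        Finset.sum_nonneg fun j _ => by positivity
      refine ⟨C + ∑ j ∈ Finset.Iic i, |H i j| * (2 * C + 1), by positivity,
        fun e δ h0 hδ k hk => ?_⟩
      rcases hk.lt_or_eq with hk | rfl
      · refine (h e δ h0 hδ k (Fin.le_castSucc_iff.2 hk)).trans ?_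
        exact mul_le_mul_of_nonneg_right (by linarith) (norm_nonneg e)
      · rw [hδ i, add_mul]
        refine (norm_sub_le _ _).trans (add_le_add (h e δ h0 hδ _ le_rfl) ?_)
        rw [Finset.sum_mul]
        refine norm_sum_le_of_le _ fun j hj => ?_
        have hj' : ‖δ j.castSucc‖ ≤ C * ‖e‖ :=
          h e δ h0 hδ _ (Fin.castSucc_le_castSucc_iff.2 (Finset.mem_Iic.1 hj))
        rw [norm_smul, Real.norm_eq_abs, mul_assoc]
        refine mul_le_mul_of_nonneg_left ?_ (abs_nonneg _)
        have h1 : ‖(if j.castSucc = k₀ then e else 0 : E)‖ ≤ ‖e‖ := by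
          split_ifs <;> simp
        calc ‖δ j.castSucc - S (δ j.castSucc) + if j.castSucc = k₀ then e else 0‖
            ≤ ‖δ j.castSucc - S (δ j.castSucc)‖ + ‖(if j.castSucc = k₀ then e else 0 : E)‖ :=
              norm_add_le _ _
          _ ≤ (‖δ j.castSucc‖ + ‖S (δ j.castSucc)‖) + ‖e‖ := add_le_add (norm_sub_le _ _) h1
          _ ≤ (2 * C + 1) * ‖e‖ := by
            rw [S.norm_map]
            linarith
  obtain ⟨C, hC, h⟩ := hbound (Fin.last n)
  refine ⟨C, hC, fun e => ?_⟩
  obtain ⟨δ, h0, hδ⟩ := exists_iteration H (fun k x => x - S x + if k = k₀ then e else 0) (0 : E)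
  refine ⟨δ, h0, hδ, fun k => h e δ h0 hδ k (Fin.le_last k), fun k => ?_⟩
  induction k using (wellFounded_lt (α := Fin (n + 1))).induction with
  | _ k ih =>
    intro hk
    induction k using Fin.cases with
    | zero => exact h0
    | succ k =>
      have hlt : ∀ j ≤ k, j.castSucc < k.succ := fun j hj => Fin.castSucc_lt_succ_iff.2 hj
      have hz : ∀ j ≤ k, δ j.castSucc = 0 := fun j hj => ih _ (hlt j hj) ((hlt j hj).le.trans hk)
      rw [hδ k, hz k le_rfl, Finset.sum_eq_zero, sub_zero]
      intro j hj
      have hj' := Finset.mem_Iic.1 hj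
      simp [hz j hj', ((hlt j hj').trans_le hk).ne]

section Fold

variable {E : Type*} [NormedAddCommGroup E] [InnerProductSpace ℝ E]

local notation "⟪" x ", " y "⟫" => inner ℝ x y

/-- The fold along the hyperplane orthogonal to `ν`: the identity on the half-space
`⟪ν, x⟫ ≥ 0`, and the reflection in the hyperplane on the other side. -/
noncomputable def fold (ν x : E) : E := x + (2 * max (-⟪ν, x⟫) 0 / ‖ν‖ ^ 2) • ν

lemma fold_of_nonneg {ν x : E} (h : 0 ≤ ⟪ν, x⟫) : fold ν x = x := by
  simp [fold, max_eq_right (neg_nonpos.2 h)]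

lemma norm_fold_sub_sq {ν : E} (hν : ν ≠ 0) (x y : E) :
    ‖fold ν x - fold ν y‖ ^ 2 = ‖x - y‖ ^ 2 + 4 / ‖ν‖ ^ 2 *
      (max (-⟪ν, x⟫) 0 - max (-⟪ν, y⟫) 0) *
      ((max (-⟪ν, x⟫) 0 - max (-⟪ν, y⟫) 0) - (-⟪ν, x⟫ - -⟪ν, y⟫)) := by
  have h : fold ν x - fold ν y =
      (x - y) + (2 * (max (-⟪ν, x⟫) 0 - max (-⟪ν, y⟫) 0) / ‖ν‖ ^ 2) • ν := by
    rw [fold, fold, mul_sub, sub_div, sub_smul]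
    abel
  have hν' : ‖ν‖ ≠ 0 := norm_ne_zero_iff.2 hν
  rw [h, norm_add_sq_real, real_inner_smul_right, norm_smul, mul_pow, Real.norm_eq_abs, sq_abs,
    inner_sub_left, real_inner_comm ν x, real_inner_comm ν y]
  field_simp
  ring

lemma norm_fold_sub_le {ν : E} (hν : ν ≠ 0) (x y : E) : ‖fold ν x - fold ν y‖ ≤ ‖x - y‖ := by
  rw [← pow_le_pow_iff_left₀ (norm_nonneg _) (norm_nonneg _) two_ne_zero, norm_fold_sub_sq hν]
  have h : (max (-⟪ν, x⟫) 0 - max (-⟪ν, y⟫) 0) *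
      ((max (-⟪ν, x⟫) 0 - max (-⟪ν, y⟫) 0) - (-⟪ν, x⟫ - -⟪ν, y⟫)) ≤ 0 := by
    rcases max_cases (-⟪ν, x⟫) 0 with ⟨h1, h2⟩ | ⟨h1, h2⟩ <;>
      rcases max_cases (-⟪ν, y⟫) 0 with ⟨h3, h4⟩ | ⟨h3, h4⟩ <;> rw [h1, h3] <;> nlinarith
  have := mul_nonpos_of_nonneg_of_nonpos (show 0 ≤ 4 / ‖ν‖ ^ 2 by positivity) h
  linarith

end Fold

/-- The fold test: among the inequalities of the pairs of iterates, only that of `(j₀, k₀)` becomes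
strict to first order, while the square in the performance identity is of second order. -/
lemma ip_nonpos_of_mem_optimalSet {H : Matrix (Fin n) (Fin n) ℝ} (hH : H ∈ optimalSet n)
    {j₀ k₀ : Fin (n + 1)} (hjk : j₀ < k₀) : ip (nodePoly H k₀) (nodePoly H j₀) ≤ 0 := by
  have hI := isInvariant_of_mem_optimalSet hH
  obtain ⟨hL, hopt⟩ := hH
  have hN : (0 : ℝ) < (n : ℝ) + 1 := by positivity
  obtain ⟨y, h0, hy⟩ := exists_iteration H (fun _ x => x - shift n x) (ones n)
  have hd := diag_ne_zero hL hI
  obtain ⟨C, hC, hresp⟩ := exists_response H (shift n) k₀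
  -- the normal `ν₀ + ε • m` of the fold puts only the point with index `k₀` on the negative side, at
  -- distance of order `ε`; the value `2 * C` absorbs the response of the later points to the fold
  obtain ⟨ν₀, hν₀⟩ := exists_inner_eq hd h0 hy fun k => if k = j₀ then 1 else 0
  obtain ⟨m, hm⟩ := exists_inner_eq hd h0 hy fun k => if k = k₀ then -1 else 2 * C
  set K : ℝ := (2 * C + 1) ^ 2 / 2 + 4 * C * ∑ k, |ip (nodePoly H k₀) (nodePoly H k)| with hK
  suffices hε : ∀ ε : ℝ, 0 < ε → ip (nodePoly H k₀) (nodePoly H j₀) ≤ ε * K by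
    have hlim : Filter.Tendsto (fun ε : ℝ => ε * K) (nhdsWithin 0 (Set.Ioi 0)) (nhds (0 * K)) :=
      (Filter.tendsto_id.mono_left nhdsWithin_le_nhds).mul_const K
    rw [zero_mul] at hlim
    exact ge_of_tendsto hlim (Filter.eventually_of_mem self_mem_nhdsWithin hε)
  intro ε hε
  set ν := ν₀ + ε • m with hν
  have hνy : ∀ k, inner ℝ ν (y k) = (if k = j₀ then 1 else 0) + ε * if k = k₀ then -1 else 2 * C :=
    fun k => by rw [hν, inner_add_left, real_inner_smul_left, hν₀, hm]
  have hνk₀ : inner ℝ ν (y k₀) = -ε := by simp [hνy, hjk.ne']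
  have hνne : ν ≠ 0 := by
    intro h
    rw [h, inner_zero_left] at hνk₀
    linarith
  have hνpos : 0 < ‖ν‖ := norm_pos_iff.2 hνne
  -- the disturbance of the residual at `k₀` caused by the fold
  set e := -(2 * ε / ‖ν‖ ^ 2) • shift n ν with he
  have henorm : ‖e‖ = 2 * ε / ‖ν‖ := by
    rw [he, norm_smul, LinearIsometry.norm_map, Real.norm_eq_abs, abs_neg, abs_of_pos (by positivity)]
    field_simp
  obtain ⟨δ, hδ0, hδ, hδC, hδz⟩ := hresp e
  set x := y + δ with hx
  have hin : ∀ k, |inner ℝ ν (δ k)| ≤ 2 * C * ε := by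
    intro k
    refine (abs_real_inner_le_norm _ _).trans ((mul_le_mul_of_nonneg_left (hδC k) hνpos.le).trans
      (le_of_eq ?_))
    rw [henorm]
    field_simp
  have hs₀ : inner ℝ ν (x k₀) = -ε := by
    rw [hx, Pi.add_apply, hδz k₀ le_rfl, add_zero, hνk₀]
  have hs : ∀ k, k ≠ k₀ → (if k = j₀ then (1 : ℝ) else 0) ≤ inner ℝ ν (x k) ∧
      inner ℝ ν (x k) ≤ (if k = j₀ then 1 else 0) + 4 * C * ε := by
    intro k hk
    have h1 := abs_le.1 (hin k)
    rw [hx, Pi.add_apply, inner_add_right, hνy, if_neg hk]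
    constructor <;> linarith
  have hs' : ∀ k, k ≠ k₀ → 0 ≤ inner ℝ ν (x k) := fun k hk =>
    le_trans (by split_ifs <;> norm_num) (hs k hk).1
  -- only the point with index `k₀` is moved by the fold
  have hfold : ∀ k, k ≠ k₀ → fold ν (x k) = x k := fun k hk => fold_of_nonneg (hs' k hk)
  have hres : ∀ k, x k - shift n (fold ν (x k)) =
      (y k - shift n (y k)) + (δ k - shift n (δ k) + if k = k₀ then e else 0) := by
    intro k
    by_cases hk : k = k₀
    · subst hk
      rw [if_pos rfl, fold, hs₀, neg_neg, max_eq_left hε.le, map_add, map_smul, he, hx,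
        Pi.add_apply, map_add, neg_smul]
      abel
    · rw [hfold k hk, if_neg hk, hx, Pi.add_apply, map_add]
      abel
  have hiter : IsIteration H (fun k => x k - shift n (fold ν (x k))) x := by
    intro k
    simp only [hres]
    rw [hx, Pi.add_apply, Pi.add_apply, hy k, hδ k]
    simp only [smul_add, Finset.sum_add_distrib]
    abel
  have hx0 : x 0 = ones n := by rw [hx, Pi.add_apply, hδ0, add_zero, h0]
  have hlip : LipschitzWith 1 fun z => shift n (fold ν z) :=
    LipschitzWith.of_dist_le_mul fun u v => by
      rw [dist_eq_norm, dist_eq_norm, ← map_sub, LinearIsometry.norm_map]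
      simpa using norm_fold_sub_le hνne u v
  have hfold0 : fold ν (0 : EuclideanSpace ℝ (Fin (n + 1))) = 0 :=
    fold_of_nonneg (by simp)
  have hperf := hopt _ (fun z => shift n (fold ν z)) hlip 0 (by simp [hfold0]) x hiter
  have hid := performance_identity hL hI hiter 0
  set g : Fin (n + 1) → EuclideanSpace ℝ (Fin (n + 1)) :=
    fun k => x k - shift n (fold ν (x k)) with hg
  set t : Fin (n + 1) → ℝ := fun k => if k = k₀ then 0 else inner ℝ ν (x k) with ht
  have hmax : ∀ k, max (-inner ℝ ν (x k)) 0 = if k = k₀ then ε else 0 := by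
    intro k
    split_ifs with hk
    · rw [hk, hs₀, neg_neg, max_eq_left hε.le]
    · rw [max_eq_right (neg_nonpos.2 (hs' k hk))]
  have hslack : ∀ j k, slack x g j k = 2 * ε / ‖ν‖ ^ 2 *
      ((if j = k₀ then t k else 0) + if k = k₀ then t j else 0) := by
    intro j k
    have h1 : x j - x k - (g j - g k) = shift n (fold ν (x j) - fold ν (x k)) := by
      rw [map_sub]
      simp only [hg]
      abel
    have h2 := norm_sub_sq_real (x j - x k) (g j - g k)
    rw [h1, LinearIsometry.norm_map, norm_fold_sub_sq hνne, hmax, hmax] at h2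
    have h3 : slack x g j k = -(2 / ‖ν‖ ^ 2 *
        ((if j = k₀ then ε else 0) - if k = k₀ then ε else 0) *
        (((if j = k₀ then ε else 0) - if k = k₀ then ε else 0) -
          (-inner ℝ ν (x j) - -inner ℝ ν (x k)))) := by
      rw [slack]
      linear_combination (1 / 2) * h2
    rw [h3]
    simp only [ht]
    by_cases hj : j = k₀ <;> by_cases hk : k = k₀ <;> simp only [hj, hk, if_true, if_false, hs₀] <;>
      ring
  have hnorm : ‖x (Fin.last n) - shift n (fold ν (x (Fin.last n)))‖ ^ 2 = ‖g (Fin.last n)‖ ^ 2 := rfl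
  have hinner : inner ℝ (x (Fin.last n) - 0) (g (Fin.last n)) - ‖g (Fin.last n)‖ ^ 2 / 2 = 0 := by
    have h1 : x (Fin.last n) - g (Fin.last n) =
        shift n (fold ν (x (Fin.last n)) - fold ν 0) := by
      rw [hfold0, sub_zero]
      simp only [hg]
      abel
    have h2 := norm_sub_sq_real (x (Fin.last n)) (g (Fin.last n))
    rw [h1, LinearIsometry.norm_map, norm_fold_sub_sq hνne, hmax, inner_zero_right, sub_zero] at h2
    have h3 : (if Fin.last n = k₀ then ε else 0) *
        ((if Fin.last n = k₀ then ε else 0) - -inner ℝ ν (x (Fin.last n))) = 0 := by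
      split_ifs with h
      · rw [h, hs₀]
        ring
      · ring
    rw [sub_zero]
    simp only [neg_zero, max_self, sub_zero] at h2
    linear_combination (1 / 2) * h2 - (2 / ‖ν‖ ^ 2) * h3
  have hgy : y (Fin.last n) - shift n (y (Fin.last n)) = (2 / ((n : ℝ) + 1)) • ones n := by
    ext i
    rw [last_residual_shift hL h0 hy, hI, neg_neg, coeff_smul, coeff_geomPoly, if_pos (by omega)]
    simp [ones]
    ring
  have hdist : ‖x 0 - 0 - (((n : ℝ) + 1) / 2) • g (Fin.last n)‖ ^ 2 ≤
      ((n : ℝ) + 1) ^ 2 * ((2 * C + 1) ^ 2 * ε ^ 2 / ‖ν‖ ^ 2) := by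
    set r := δ (Fin.last n) - shift n (δ (Fin.last n)) + if Fin.last n = k₀ then e else 0 with hr
    have h1 : x 0 - 0 - (((n : ℝ) + 1) / 2) • g (Fin.last n) = -((((n : ℝ) + 1) / 2) • r) := by
      have h2 : (((n : ℝ) + 1) / 2) • (2 / ((n : ℝ) + 1)) • ones n = ones n := by
        rw [smul_smul]
        field_simp
        exact one_smul _ _
      simp only [hg]
      rw [hres, hgy, hx0, smul_add, h2, sub_zero]
      abel
    have h2 : ‖r‖ ≤ (2 * C + 1) * ‖e‖ := by
      have h3 : ‖(if Fin.last n = k₀ then e else 0)‖ ≤ ‖e‖ := by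
        split_ifs <;> simp
      have h4 := norm_sub_le (δ (Fin.last n)) (shift n (δ (Fin.last n)))
      rw [LinearIsometry.norm_map] at h4
      have h5 := norm_add_le (δ (Fin.last n) - shift n (δ (Fin.last n)))
        (if Fin.last n = k₀ then e else 0)
      have h6 := hδC (Fin.last n)
      rw [← hr] at h5
      linarith
    rw [h1, norm_neg, norm_smul, mul_pow, Real.norm_eq_abs, sq_abs]
    have h3 : ‖r‖ ^ 2 ≤ ((2 * C + 1) * ‖e‖) ^ 2 := by gcongr
    rw [henorm] at h3
    calc (((n : ℝ) + 1) / 2) ^ 2 * ‖r‖ ^ 2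
        ≤ (((n : ℝ) + 1) / 2) ^ 2 * ((2 * C + 1) * (2 * ε / ‖ν‖)) ^ 2 := by gcongr
      _ = _ := by
        field_simp
  have hsum : ∑ j, ∑ k, ip (nodePoly H j) (nodePoly H k) * slack x g j k =
      4 * ε / ‖ν‖ ^ 2 * ∑ k, ip (nodePoly H k₀) (nodePoly H k) * t k := by
    have h1 : ∀ j k, ip (nodePoly H j) (nodePoly H k) * slack x g j k = 2 * ε / ‖ν‖ ^ 2 *
        ((if j = k₀ then ip (nodePoly H j) (nodePoly H k) * t k else 0) +
          if k = k₀ then ip (nodePoly H k) (nodePoly H j) * t j else 0) := by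
      intro j k
      rw [hslack, ip_comm (nodePoly H k)]
      split_ifs <;> ring
    simp only [h1, ← Finset.mul_sum, Finset.sum_add_distrib]
    rw [Finset.sum_comm]
    simp only [Finset.sum_ite_eq', Finset.mem_univ, if_true]
    ring
  -- the optimal rate bounds the weighted sum of the slacks at `k₀` by a multiple of `ε`
  have hle : ∑ k, ip (nodePoly H k₀) (nodePoly H k) * t k ≤ (2 * C + 1) ^ 2 / 2 * ε := by
    rw [hinner, mul_zero, add_zero, hsum] at hid
    rw [hnorm, le_div_iff₀ (by positivity)] at hperf
    have h1 : ((n : ℝ) + 1) ^ 2 / 2 *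
        (4 * ε / ‖ν‖ ^ 2 * ∑ k, ip (nodePoly H k₀) (nodePoly H k) * t k) ≤
        ((n : ℝ) + 1) ^ 2 * ((2 * C + 1) ^ 2 * ε ^ 2 / ‖ν‖ ^ 2) := by
      linarith
    have h2 : 0 < ((n : ℝ) + 1) ^ 2 * 2 * ε / ‖ν‖ ^ 2 := by positivity
    refine le_of_mul_le_mul_left ?_ h2
    refine le_trans (le_of_eq ?_) (h1.trans (le_of_eq ?_)) <;> field_simp
    ring
  have hterm : ∀ k, (if k = j₀ then ip (nodePoly H k₀) (nodePoly H k) else 0) -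
      4 * C * ε * |ip (nodePoly H k₀) (nodePoly H k)| ≤ ip (nodePoly H k₀) (nodePoly H k) * t k := by
    intro k
    set c := ip (nodePoly H k₀) (nodePoly H k)
    have hCε : 0 ≤ 4 * C * ε := by positivity
    by_cases hk : k = k₀
    · simp only [ht, hk, if_true, hjk.ne', if_false]
      have := mul_nonneg hCε (abs_nonneg c)
      linarith
    · have h1 := hs k hk
      simp only [ht, if_neg hk]
      have h2 : |c * (inner ℝ ν (x k) - if k = j₀ then 1 else 0)| ≤ |c| * (4 * C * ε) := by
        rw [abs_mul]
        refine mul_le_mul_of_nonneg_left (abs_le.2 ⟨?_, ?_⟩) (abs_nonneg c) <;> linarith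
      have h3 := (abs_le.1 h2).1
      have h4 : c * (if k = j₀ then (1 : ℝ) else 0) = if k = j₀ then c else 0 := by
        split_ifs <;> ring
      rw [← h4]
      linarith
  have h1 := Finset.sum_le_sum fun k (_ : k ∈ Finset.univ) => hterm k
  rw [Finset.sum_sub_distrib, ← Finset.mul_sum] at h1
  simp only [Finset.sum_ite_eq', Finset.mem_univ, if_true] at h1
  rw [hK]
  linarith

theorem isCertified_of_mem_optimalSet {H : Matrix (Fin n) (Fin n) ℝ} (hH : H ∈ optimalSet n) :
    IsCertified H := by
  intro j k hjk
  rw [cert_eq_ip, ip_comm, neg_mul]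
  have := ip_nonpos_of_mem_optimalSet hH hjk
  have hN : (0 : ℝ) < (n : ℝ) + 1 := by positivity
  nlinarith

/-- Optimality is equivalent to H-invariance together with nonnegativity of the H-certificates. -/
theorem mem_optimalSet_iff {H : Matrix (Fin n) (Fin n) ℝ} :
    H ∈ optimalSet n ↔ IsLowerTri H ∧ IsInvariant H ∧ IsCertified H :=
  ⟨fun h => ⟨h.1, isInvariant_of_mem_optimalSet h, isCertified_of_mem_optimalSet h⟩,
    fun h => mem_optimalSet_of_isCertified h.1 h.2.1 h.2.2⟩

/-! ### Triangular families of polynomials -/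

lemma exists_sum_smul_eq_of_triangular {m : ℕ} (v : Fin m → ℝ[X])
    (hv : ∀ i, (v i).natDegree ≤ m - 1 - i) (hv' : ∀ i, (v i).coeff (m - 1 - i) ≠ 0) (q : ℝ[X])
    (hq : ∀ d, m ≤ d → q.coeff d = 0) : ∃ c : Fin m → ℝ, q = ∑ i, c i • v i := by
  induction m generalizing q with
  | zero => exact ⟨0, by ext d; simpa using hq d (Nat.zero_le d)⟩
  | succ m ih =>
    have h0 := hv' 0
    have h0' := hv 0
    simp only [Fin.val_zero, Nat.add_sub_cancel, Nat.sub_zero] at h0 h0'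
    obtain ⟨c, hc⟩ := ih (fun i => v i.succ)
      (fun i => (hv i.succ).trans (by simp only [Fin.val_succ]; omega))
      (fun i => by
        have := hv' i.succ
        rwa [show m + 1 - 1 - (i.succ : ℕ) = m - 1 - i by simp only [Fin.val_succ]; omega] at this)
      (q - (q.coeff m / (v 0).coeff m) • v 0) (fun d hd => by
        rw [coeff_sub, coeff_smul, smul_eq_mul]
        rcases hd.eq_or_lt with rfl | hd
        · rw [div_mul_cancel₀ _ h0, sub_self]
        · rw [hq d hd, coeff_eq_zero_of_natDegree_lt (h0'.trans_lt hd)]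
          simp)
    refine ⟨Fin.cons (q.coeff m / (v 0).coeff m) c, ?_⟩
    rw [Fin.sum_univ_succ]
    simp only [Fin.cons_zero, Fin.cons_succ]
    rw [← hc]
    abel

lemma eq_zero_of_sum_smul_eq_zero_of_triangular {m : ℕ} (v : Fin m → ℝ[X])
    (hv : ∀ i, (v i).natDegree ≤ m - 1 - i) (hv' : ∀ i, (v i).coeff (m - 1 - i) ≠ 0)
    (c : Fin m → ℝ) (hc : ∑ i, c i • v i = 0) : c = 0 := by
  induction m with
  | zero => exact Subsingleton.elim _ _
  | succ m ih =>
    have h0 := hv' 0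
    simp only [Fin.val_zero, Nat.add_sub_cancel, Nat.sub_zero] at h0
    rw [Fin.sum_univ_succ] at hc
    have hc0 : c 0 = 0 := by
      have h := congrArg (fun q => q.coeff m) hc
      simp only [coeff_add, coeff_smul, finsetSum_coeff, coeff_zero, smul_eq_mul] at h
      rw [Finset.sum_eq_zero, add_zero] at h
      · exact (mul_eq_zero.1 h).resolve_right h0
      · intro i _
        rw [coeff_eq_zero_of_natDegree_lt, mul_zero]
        refine (hv i.succ).trans_lt ?_
        have := i.2
        simp only [Fin.val_succ]
        omega
    rw [hc0, zero_smul, zero_add] at hc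
    have h := ih (fun i => v i.succ)
      (fun i => (hv i.succ).trans (by simp only [Fin.val_succ]; omega))
      (fun i => by
        have := hv' i.succ
        rwa [show m + 1 - 1 - (i.succ : ℕ) = m - 1 - i by simp only [Fin.val_succ]; omega] at this)
      (fun i => c i.succ) hc
    funext i
    refine Fin.cases hc0 (fun i => ?_) i
    exact congrFun h i

/-- A functional which vanishes on the members of a triangular family after position `j` vanishes on
all polynomials of degree less than `n - j`. -/
lemma map_eq_zero_of_triangular {f : Fin (n + 1) → ℝ[X]} (hf : ∀ k, (f k).natDegree ≤ n - k)
    (hf' : ∀ k, (f k).coeff (n - k) ≠ 0) (φ : ℝ[X] →ₗ[ℝ] ℝ) (j : Fin (n + 1))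
    (hφ : ∀ k, j < k → φ (f k) = 0) (d : ℕ) (hd : d ≤ n - j) (q : ℝ[X])
    (hq : ∀ e, d ≤ e → q.coeff e = 0) : φ q = 0 := by
  induction d generalizing q with
  | zero =>
    have : q = 0 := by
      ext e
      simpa using hq e (Nat.zero_le e)
    rw [this, map_zero]
  | succ d ih =>
    set k : Fin (n + 1) := ⟨n - d, by omega⟩ with hk
    have hkd : n - (k : ℕ) = d := by
      simp only [hk]
      omega
    have h1 := hf k
    have h2 := hf' k
    rw [hkd] at h1 h2
    have h3 := ih (by omega) (q - (q.coeff d / (f k).coeff d) • f k) (fun e he => by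
      rw [coeff_sub, coeff_smul, smul_eq_mul]
      rcases he.eq_or_lt with rfl | he
      · rw [div_mul_cancel₀ _ h2, sub_self]
      · rw [hq e he, coeff_eq_zero_of_natDegree_lt (h1.trans_lt he)]
        simp)
    have hjk : j < k := by
      rw [Fin.lt_def]
      simp only [hk]
      omega
    rwa [map_sub, map_smul, hφ k hjk, smul_zero, sub_zero] at h3

/-- A polynomial of degree at most `n - j` which vanishes at `1` and is orthogonal to the node
polynomials of all nodes after `j` is zero. -/
lemma eq_zero_of_ip_nodePoly_eq_zero {H : Matrix (Fin n) (Fin n) ℝ} (hH : IsLowerTri H)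
    (hI : IsInvariant H) (j : Fin (n + 1)) {q : ℝ[X]} (hq : q.natDegree ≤ n - j)
    (hq1 : q.eval 1 = 0) (h : ∀ k, j < k → ip q (nodePoly H k) = 0) : q = 0 := by
  have h1 : ∀ d, d < n - j → q.coeff d = 0 := by
    intro d hd
    rw [← ip_X_pow, ip_comm]
    refine map_eq_zero_of_triangular (natDegree_nodePoly_le hH) (coeff_nodePoly_ne_zero hH hI)
      (ip q) j h (d + 1) hd _ fun e he => ?_
    rw [coeff_X_pow, if_neg (by omega)]
  have h2 : q.coeff (n - j) = 0 := by
    rw [eval_eq_sum_range' (Nat.lt_succ_of_le hq), Finset.sum_range_succ, Finset.sum_eq_zero] at hq1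
    · simpa using hq1
    · intro d hd
      rw [h1 d (Finset.mem_range.1 hd), zero_mul]
  ext d
  rcases lt_trichotomy d (n - j) with hd | rfl | hd
  · exact h1 d hd
  · exact h2
  · exact coeff_eq_zero_of_natDegree_lt (hq.trans_lt hd)

/-! ### Arcs and vertices -/

lemma nodePoly_ne_zero {H : Matrix (Fin n) (Fin n) ℝ} (hH : IsLowerTri H)
    (hI : IsInvariant H) (j : Fin (n + 1)) : nodePoly H j ≠ 0 := by
  intro h
  have := coeff_nodePoly_ne_zero hH hI j
  rw [h] at this
  simp at this

lemma isArc_iff_ip_neg {H : Matrix (Fin n) (Fin n) ℝ} {j : Fin n} {k : Fin (n + 1)} :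
    IsArc H j k ↔ j.castSucc < k ∧ ip (nodePoly H j.castSucc) (nodePoly H k) < 0 := by
  rw [IsArc, cert_eq_ip, neg_mul, neg_pos]
  have hN : (0 : ℝ) < (n : ℝ) + 1 := by positivity
  exact and_congr_right fun _ => by simp [mul_neg_iff, hN, hN.not_gt]

lemma ip_eq_zero_of_not_isArc {H : Matrix (Fin n) (Fin n) ℝ} (hC : IsCertified H) {j : Fin n}
    {k : Fin (n + 1)} (hjk : j.castSucc < k) (h : ¬ IsArc H j k) :
    ip (nodePoly H j.castSucc) (nodePoly H k) = 0 := by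
  rw [isArc_iff_ip_neg, not_and, not_lt] at h
  exact le_antisymm (hC.ip_nonpos hjk) (h hjk)

/-- Without an arc to a later node, `f_j` would be orthogonal to all polynomials of smaller degree, so
it would be a nonzero multiple of a power of `X`, which does not vanish at `1`. -/
lemma exists_isArc {H : Matrix (Fin n) (Fin n) ℝ} (hH : H ∈ optimalSet n) (j : Fin n) :
    ∃ k, IsArc H j k := by
  obtain ⟨hL, hI, hC⟩ := mem_optimalSet_iff.1 hH
  by_contra! h
  exact nodePoly_ne_zero hL hI j.castSucc (eq_zero_of_ip_nodePoly_eq_zero hL hI j.castSucc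
    (natDegree_nodePoly_le hL _) (eval_one_nodePoly hL j)
    fun k hk => ip_eq_zero_of_not_isArc hC hk (h k))

/-- The arc diagram of `H` is a tree rooted at the last node: every other node has exactly one arc
to a later node. -/
def IsTree (H : Matrix (Fin n) (Fin n) ℝ) : Prop := ∀ j : Fin n, ∃! k, IsArc H j k

lemma ncard_zeroCerts_add {H : Matrix (Fin n) (Fin n) ℝ} (hH : H ∈ optimalSet n) :
    (zeroCerts H).ncard + {p : Fin n × Fin (n + 1) | IsArc H p.1 p.2}.ncard =
      {p : Fin n × Fin (n + 1) | p.1.castSucc < p.2}.ncard := by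
  have hC := isCertified_of_mem_optimalSet hH
  rw [← Set.ncard_union_eq _ (Set.toFinite _) (Set.toFinite _)]
  · congr 1
    ext p
    simp only [zeroCerts, IsArc, Set.mem_union, Set.mem_ofPred_eq, ← and_or_left,
      and_iff_left_iff_imp]
    intro h
    rcases (hC p.1 p.2 h).eq_or_lt with h | h
    · exact Or.inl h.symm
    · exact Or.inr h
  · rw [Set.disjoint_left]
    rintro p ⟨_, h⟩ ⟨_, h'⟩
    exact h'.ne' h

lemma image_fst_arcs {H : Matrix (Fin n) (Fin n) ℝ} (hH : H ∈ optimalSet n) :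
    Prod.fst '' {p : Fin n × Fin (n + 1) | IsArc H p.1 p.2} = Set.univ := by
  ext j
  obtain ⟨k, hk⟩ := exists_isArc hH j
  simpa using ⟨k, hk⟩

lemma le_ncard_arcs {H : Matrix (Fin n) (Fin n) ℝ} (hH : H ∈ optimalSet n) :
    n ≤ {p : Fin n × Fin (n + 1) | IsArc H p.1 p.2}.ncard := by
  have h := Set.ncard_image_le (f := Prod.fst)
    (Set.toFinite {p : Fin n × Fin (n + 1) | IsArc H p.1 p.2})
  rw [image_fst_arcs hH, Set.ncard_univ, Nat.card_fin] at h
  exact h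

lemma isTree_iff_ncard_arcs_le {H : Matrix (Fin n) (Fin n) ℝ} (hH : H ∈ optimalSet n) :
    IsTree H ↔ {p : Fin n × Fin (n + 1) | IsArc H p.1 p.2}.ncard ≤ n := by
  have h : IsTree H ↔ Set.InjOn Prod.fst {p : Fin n × Fin (n + 1) | IsArc H p.1 p.2} := by
    constructor
    · rintro h ⟨j, k⟩ hk ⟨j', k'⟩ hk' (rfl : j = j')
      exact Prod.ext rfl ((h j).unique hk hk')
    · intro h j
      obtain ⟨k, hk⟩ := exists_isArc hH j
      exact ⟨k, hk, fun k' hk' =>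
        congrArg Prod.snd (@h (j, k') hk' (j, k) hk rfl)⟩
  rw [h, ← Set.ncard_image_iff (Set.toFinite _), image_fst_arcs hH, Set.ncard_univ, Nat.card_fin]
  have := le_ncard_arcs hH
  omega

/-- Every node but the last has an arc, so the number of vanishing certificates is largest when there
is only one arc per node, provided that some optimal `H₀` has this property. -/
lemma isVertex_iff {H₀ : Matrix (Fin n) (Fin n) ℝ} (h₀ : H₀ ∈ optimalSet n) (ht : IsTree H₀)
    (H : Matrix (Fin n) (Fin n) ℝ) : IsVertex H ↔ H ∈ optimalSet n ∧ IsTree H := by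
  rw [isTree_iff_ncard_arcs_le h₀] at ht
  have e₀ := ncard_zeroCerts_add h₀
  constructor
  · rintro ⟨h, hmax⟩
    refine ⟨h, (isTree_iff_ncard_arcs_le h).2 ?_⟩
    have e := ncard_zeroCerts_add h
    have := hmax H₀ h₀
    omega
  · rintro ⟨h, htree⟩
    rw [isTree_iff_ncard_arcs_le h] at htree
    refine ⟨h, fun H' h' => ?_⟩
    have e := ncard_zeroCerts_add h
    have e' := ncard_zeroCerts_add h'
    have := le_ncard_arcs h'
    omega

lemma tailSum_nodePoly_triangular {H : Matrix (Fin n) (Fin n) ℝ} (hH : IsLowerTri H)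
    (hI : IsInvariant H) (i : Fin n) :
    (tailSum (nodePoly H) i).natDegree ≤ n - 1 - i ∧
      (tailSum (nodePoly H) i).coeff (n - 1 - i) ≠ 0 := by
  refine ⟨natDegree_tailSum_le fun k _ => natDegree_nodePoly_le hH k, ?_⟩
  have h := coeff_nodePoly_ne_zero hH hI i.succ
  rw [show n - (i.succ : ℕ) = n - 1 - i by simp only [Fin.val_succ]; omega] at h
  rw [tailSum, finsetSum_coeff, Finset.sum_eq_single i.succ]
  · exact h
  · intro k hk hki
    apply coeff_eq_zero_of_natDegree_lt
    refine (natDegree_nodePoly_le hH k).trans_lt ?_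
    simp only [Finset.mem_Ioi, Fin.lt_def, Fin.val_castSucc, ne_eq, Fin.ext_iff,
      Fin.val_succ] at hk hki
    omega
  · intro h
    exact absurd (Finset.mem_Ioi.2 (Fin.castSucc_lt_succ)) h

lemma one_sub_X_ne_zero : (1 - X : ℝ[X]) ≠ 0 := by
  intro h
  have := congrArg (eval 0) h
  simp at this

/-- An invariant step-size matrix is determined by its node polynomials. -/
lemma eq_of_nodePoly_eq {H H' : Matrix (Fin n) (Fin n) ℝ} (hH : IsLowerTri H)
    (hI : IsInvariant H) (hH' : IsLowerTri H') (h : nodePoly H = nodePoly H') : H = H' := by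
  ext i j
  have h1 : quotPoly H j = quotPoly H' j := by
    refine mul_left_cancel₀ one_sub_X_ne_zero ?_
    rw [← nodePoly_eq_mul_quotPoly hH, ← nodePoly_eq_mul_quotPoly hH', h]
  rw [quotPoly, quotPoly, ← h, neg_inj, ← sub_eq_zero, ← Finset.sum_sub_distrib] at h1
  simp only [← sub_smul] at h1
  have h2 := eq_zero_of_sum_smul_eq_zero_of_triangular (tailSum (nodePoly H))
    (fun i => (tailSum_nodePoly_triangular hH hI i).1)
    (fun i => (tailSum_nodePoly_triangular hH hI i).2) (fun i => H i j - H' i j) h1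
  exact sub_eq_zero.1 (congrFun h2 i)

/-- A matrix whose arc diagram is a tree is determined by this tree: going down from the last node,
each node polynomial is determined up to a factor by orthogonality to all later ones but one, and
by vanishing at `1`; the factors are determined by the invariance condition. -/
theorem eq_of_same_arcs {H H' : Matrix (Fin n) (Fin n) ℝ} (hH : H ∈ optimalSet n)
    (hH' : H' ∈ optimalSet n) (κ : Fin n → Fin (n + 1)) (hκ : ∀ j k, IsArc H j k ↔ k = κ j)
    (hκ' : ∀ j k, IsArc H' j k ↔ k = κ j) : H = H' := by
  obtain ⟨hL, hI, hC⟩ := mem_optimalSet_iff.1 hH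
  obtain ⟨hL', hI', hC'⟩ := mem_optimalSet_iff.1 hH'
  have hprop : ∀ k, ∃ c : ℝ, nodePoly H' k = c • nodePoly H k := by
    intro k
    induction k using downward_induction with
    | hlast => exact ⟨1, by rw [nodePoly_last, nodePoly_last, one_smul]⟩
    | h j ih =>
      have hr := (isArc_iff_ip_neg.1 ((hκ j _).2 rfl)).2
      set r := ip (nodePoly H j.castSucc) (nodePoly H (κ j)) with hr'
      set r' := ip (nodePoly H' j.castSucc) (nodePoly H (κ j)) with hr''
      refine ⟨r' / r, sub_eq_zero.1 (eq_zero_of_ip_nodePoly_eq_zero hL hI j.castSucc ?_ ?_ ?_)⟩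
      · exact (natDegree_sub_le_of_le (natDegree_nodePoly_le hL' _)
          ((natDegree_smul_le _ _).trans (natDegree_nodePoly_le hL _))).trans (by simp)
      · simp [eval_one_nodePoly hL, eval_one_nodePoly hL']
      · intro k hk
        rw [map_sub, map_smul, LinearMap.sub_apply, LinearMap.smul_apply, smul_eq_mul]
        by_cases hkκ : k = κ j
        · rw [hkκ, ← hr', ← hr'', div_mul_cancel₀ _ hr.ne, sub_self]
        · rw [ip_eq_zero_of_not_isArc hC hk fun h => hkκ ((hκ j k).1 h), mul_zero, sub_zero]
          have h1 := ip_eq_zero_of_not_isArc hC' hk fun h => hkκ ((hκ' j k).1 h)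
          obtain ⟨c, hc⟩ := ih k hk
          have hc0 : c ≠ 0 := by
            rintro rfl
            rw [zero_smul] at hc
            exact nodePoly_ne_zero hL' hI' k hc
          rw [hc, map_smul, smul_eq_mul] at h1
          exact (mul_eq_zero.1 h1).resolve_left hc0
  choose c hc using hprop
  have hsum : ∑ k, (c k - 1) • nodePoly H k = 0 := by
    simp only [sub_smul, one_smul, Finset.sum_sub_distrib, ← hc]
    rw [hI, hI', sub_self]
  have hc1 := eq_zero_of_sum_smul_eq_zero_of_triangular (nodePoly H)
    (fun k => by simpa using natDegree_nodePoly_le hL k)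
    (fun k => by simpa using coeff_nodePoly_ne_zero hL hI k) _ hsum
  refine eq_of_nodePoly_eq hL hI hL' (funext fun k => ?_)
  rw [hc k, sub_eq_zero.1 (congrFun hc1 k), one_smul]

/-! ### The polynomial of the inserted node -/

/-- The polynomial of the inserted node `N'` of a gluing: up to a factor, the only polynomial of
degree at most `b + 1` which vanishes at `1` and is orthogonal to all polynomials of degree at most
`b` which vanish at `1`. -/
noncomputable def midPoly (a b : ℕ) : ℝ[X] :=
  (((a : ℝ) + 1) / (((a : ℝ) + b + 2) * ((b : ℝ) + 1))) •
    (geomPoly b - ((b : ℝ) + 1) • X ^ (b + 1))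

lemma geomPoly_succ (n : ℕ) : geomPoly (n + 1) = geomPoly n + X ^ (n + 1) := by
  rw [geomPoly, geomPoly, Finset.sum_range_succ]

lemma geomPoly_glue (a b : ℕ) :
    geomPoly (a + 1 + b) = geomPoly b + X ^ (b + 1) * geomPoly a := by
  rw [geomPoly, geomPoly, geomPoly, show a + 1 + b + 1 = (b + 1) + (a + 1) by omega,
    Finset.sum_range_add, Finset.mul_sum]
  simp only [pow_add]

lemma X_sub_one_mul_derivative_geomPoly (b : ℕ) :
    (X - 1) * derivative (geomPoly (b + 1)) = ((b : ℝ) + 1) • X ^ (b + 1) - geomPoly b := by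
  have h : geomPoly (b + 1) * (X - 1) = X ^ (b + 2) - 1 := geom_sum_mul X (b + 2)
  have h' := congrArg derivative h
  rw [derivative_mul] at h'
  simp only [derivative_sub, derivative_X, derivative_one, derivative_X_pow, sub_zero,
    mul_one] at h'
  rw [geomPoly_succ] at h' ⊢
  rw [smul_eq_C_mul]
  simp only [map_add, map_one, map_natCast, map_ofNat, Nat.cast_add, Nat.cast_ofNat,
    Nat.reduceSubDiff] at h' ⊢
  linear_combination h'

lemma midPoly_eq (a b : ℕ) : midPoly a b =
    (1 - X) * ((((a : ℝ) + 1) / (((a : ℝ) + b + 2) * ((b : ℝ) + 1))) •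
      derivative (geomPoly (b + 1))) := by
  rw [midPoly, mul_smul_comm]
  congr 1
  rw [← neg_sub X, neg_mul, X_sub_one_mul_derivative_geomPoly, neg_sub]

lemma coeff_midPoly_comp (a b k : ℕ) : ((midPoly a b).comp (X + 1)).coeff k =
    -(((a : ℝ) + 1) / (((a : ℝ) + b + 2) * ((b : ℝ) + 1)) * (k * ((b + 2).choose (k + 1) : ℝ))) := by
  have h : (geomPoly (b + 1)).comp (X + 1) =
      ∑ i ∈ Finset.range (b + 2), ((b + 2).choose (i + 1) : ℝ[X]) * X ^ i := by
    rw [geomPoly, geom_sum_X_comp_X_add_one_eq_sum]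
  have h1 : (midPoly a b).comp (X + 1) = -((((a : ℝ) + 1) / (((a : ℝ) + b + 2) * ((b : ℝ) + 1))) •
      (derivative ((geomPoly (b + 1)).comp (X + 1)) * X)) := by
    rw [midPoly_eq, derivative_comp]
    simp [mul_comm]
  rw [h1, coeff_neg, coeff_smul, smul_eq_mul]
  congr 2
  rcases k with _ | k
  · simp
  · rw [coeff_mul_X, coeff_derivative, h, finsetSum_coeff]
    have h2 : ∀ i, (((b + 2).choose (i + 1) : ℝ[X]) * X ^ i).coeff (k + 1) =
        if i = k + 1 then ((b + 2).choose (k + 2) : ℝ) else 0 := by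
      intro i
      rw [← map_natCast C, coeff_C_mul_X_pow]
      by_cases hi : i = k + 1
      · simp [hi]
      · rw [if_neg (fun h => hi h.symm), if_neg hi]
    simp only [h2, Finset.sum_ite_eq', Finset.mem_range]
    split_ifs with hk
    · push_cast
      ring
    · rw [Nat.choose_eq_zero_of_lt (by omega)]
      simp

/-- The prescribed value of `Q(k + 1, N')` is the coefficient of `midPoly` in powers of `1 - X`. -/
lemma column_value_eq (a b k : ℕ) :
    ((a : ℝ) + 1) * ((b : ℝ) + 2) / (((a : ℝ) + b + 2) * (((k + 1 : ℕ) : ℝ) + 1)) *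
      (b.choose k : ℝ) = ((a : ℝ) + 1) / (((a : ℝ) + b + 2) * ((b : ℝ) + 1)) *
        (((k + 1 : ℕ) : ℝ) * ((b + 2).choose (k + 2) : ℝ)) := by
  have h1 : ((b : ℝ) + 1) * (b.choose k : ℝ) = ((b + 1).choose (k + 1) : ℝ) * ((k : ℝ) + 1) := by
    exact_mod_cast Nat.add_one_mul_choose_eq b k
  have h2 : ((b : ℝ) + 2) * ((b + 1).choose (k + 1) : ℝ) =
      ((b + 2).choose (k + 2) : ℝ) * ((k : ℝ) + 2) := by
    exact_mod_cast Nat.add_one_mul_choose_eq (b + 1) (k + 1)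
  have h3 : (a : ℝ) + b + 2 ≠ 0 := by positivity
  have h4 : (b : ℝ) + 1 ≠ 0 := by positivity
  have h5 : (k : ℝ) + 1 + 1 ≠ 0 := by positivity
  push_cast
  field_simp
  linear_combination ((b : ℝ) + 2) * h1 + ((k : ℝ) + 1) * h2

variable {a b : ℕ}

lemma coeff_nodePoly_comp {n : ℕ} (H : Matrix (Fin n) (Fin n) ℝ) (j : Fin n) (k : ℕ) :
    ((nodePoly H j.castSucc).comp (X + 1)).coeff k = if k ∈ Finset.Icc 1 n then -Q H k j else 0 := by
  have h : ∀ m ∈ Finset.Icc 1 n, (((-1 : ℝ) ^ (m - 1) * Q H m j) • (1 - X : ℝ[X]) ^ m).comp (X + 1) =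
      C (-Q H m j) * X ^ m := by
    intro m hm
    obtain ⟨m, rfl⟩ : ∃ l, m = l + 1 := ⟨m - 1, by have := (Finset.mem_Icc.1 hm).1; omega⟩
    have e : (-1 : ℝ[X]) ^ m * (-1) ^ m = 1 := by
      rw [← mul_pow]
      simp
    rw [smul_comp, pow_comp, show (1 - X : ℝ[X]).comp (X + 1) = -X by simp, neg_pow (X : ℝ[X]),
      smul_eq_C_mul, pow_succ (-1 : ℝ[X])]
    simp only [Nat.add_sub_cancel, map_mul, map_pow, map_neg, map_one]
    linear_combination (-C (Q H (m + 1) j) * X ^ (m + 1)) * e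
  rw [nodePoly_castSucc, Polynomial.sum_comp, Finset.sum_congr rfl h, finsetSum_coeff]
  simp only [coeff_C_mul_X_pow]
  rw [Finset.sum_ite_eq]

/-- The condition on the column of the inserted node says that its node polynomial is `midPoly`. -/
lemma nodePoly_mid_eq_iff (H : Matrix (Fin (a + 1 + b)) (Fin (a + 1 + b)) ℝ) :
    nodePoly H (midIdx a b).castSucc = midPoly a b ↔
      ∀ k ∈ Finset.Icc 1 (b + 1), Q H k (midIdx a b) =
        ((a : ℝ) + 1) * ((b : ℝ) + 2) / (((a : ℝ) + b + 2) * ((k : ℝ) + 1)) *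
          (b.choose (k - 1) : ℝ) := by
  have hinj : nodePoly H (midIdx a b).castSucc = midPoly a b ↔
      (nodePoly H (midIdx a b).castSucc).comp (X + 1) = (midPoly a b).comp (X + 1) := by
    have := (taylor_injective (1 : ℝ)).eq_iff (a := nodePoly H (midIdx a b).castSucc)
      (b := midPoly a b)
    simp only [taylor_apply, map_one] at this
    exact this.symm
  rw [hinj, Polynomial.ext_iff]
  simp only [coeff_nodePoly_comp, coeff_midPoly_comp]
  constructor
  · intro h k hk
    obtain ⟨k, rfl⟩ : ∃ l, k = l + 1 := ⟨k - 1, by have := (Finset.mem_Icc.1 hk).1; omega⟩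
    have hk' := h (k + 1)
    rw [if_pos (by simp only [Finset.mem_Icc] at hk ⊢; omega), neg_inj] at hk'
    rw [hk', Nat.add_sub_cancel, column_value_eq]
  · intro h k
    by_cases hk : k ∈ Finset.Icc 1 (b + 1)
    · have hk' := h k hk
      obtain ⟨k, rfl⟩ : ∃ l, k = l + 1 := ⟨k - 1, by have := (Finset.mem_Icc.1 hk).1; omega⟩
      rw [if_pos (by simp only [Finset.mem_Icc] at hk ⊢; omega), hk', Nat.add_sub_cancel,
        column_value_eq]
    · have h0 : (k : ℝ) * ((b + 2).choose (k + 1) : ℝ) = 0 := by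
        rcases k with _ | k
        · simp
        · rw [Nat.choose_eq_zero_of_lt (by simp only [Finset.mem_Icc] at hk; omega)]
          simp
      rw [h0, mul_zero, neg_zero]
      split_ifs with hk'
      · rw [Q_eq_zero, neg_zero]
        simp only [Finset.mem_Icc] at hk hk'
        simp only [midIdx, Fin.val_castAdd, Fin.val_last]
        omega
      · rfl

/-! ### Node polynomials of gluings -/

/-- A node of the left part of a gluing, among which the inserted node is the last. -/
def leftNode (b : ℕ) (k : Fin (a + 1)) : Fin (a + 1 + b + 1) := Fin.castAdd (b + 1) k

/-- A node of the right part of a gluing. -/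
def rightNode (a : ℕ) (k : Fin (b + 1)) : Fin (a + 1 + b + 1) := Fin.natAdd (a + 1) k

lemma val_leftNode (k : Fin (a + 1)) : (leftNode b k : ℕ) = k := rfl

lemma val_rightNode (k : Fin (b + 1)) : (rightNode a k : ℕ) = a + 1 + k := rfl

lemma castSucc_leftIdx (j : Fin a) : (leftIdx b j).castSucc = leftNode b j.castSucc := rfl

lemma castSucc_midIdx : (midIdx a b).castSucc = leftNode b (Fin.last a) := rfl

lemma castSucc_rightIdx (j : Fin b) : (rightIdx a j).castSucc = rightNode a j.castSucc := rfl

lemma idx_cases {P : Fin (a + 1 + b) → Prop} (hl : ∀ i, P (leftIdx b i)) (hm : P (midIdx a b))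
    (hr : ∀ i, P (rightIdx a i)) (i : Fin (a + 1 + b)) : P i := by
  refine Fin.addCases (fun i => ?_) hr i
  exact Fin.lastCases hm hl i

lemma node_cases {P : Fin (a + 1 + b + 1) → Prop} (hl : ∀ k, P (leftNode b k))
    (hr : ∀ k, P (rightNode a k)) (k : Fin (a + 1 + b + 1)) : P k :=
  Fin.addCases (m := a + 1) (n := b + 1) hl hr k

lemma sum_idx {M : Type*} [AddCommMonoid M] (u : Fin (a + 1 + b) → M) :
    ∑ i, u i = ∑ i, u (leftIdx b i) + u (midIdx a b) + ∑ i, u (rightIdx a i) := by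
  rw [Fin.sum_univ_add, Fin.sum_univ_castSucc]
  rfl

lemma sum_node {M : Type*} [AddCommMonoid M] (u : Fin (a + 1 + b + 1) → M) :
    ∑ k, u k = ∑ k, u (leftNode b k) + ∑ k, u (rightNode a k) :=
  Fin.sum_univ_add (a := a + 1) (b := b + 1) u

lemma leftNode_lt_leftNode {j k : Fin (a + 1)} : leftNode b j < leftNode b k ↔ j < k := Iff.rfl

lemma rightNode_lt_rightNode {j k : Fin (b + 1)} : rightNode a j < rightNode a k ↔ j < k := by
  simp only [Fin.lt_def, val_rightNode]
  omega

lemma leftNode_lt_rightNode (j : Fin (a + 1)) (k : Fin (b + 1)) : leftNode b j < rightNode a k := by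
  simp only [Fin.lt_def, val_rightNode, val_leftNode]
  omega

lemma tailSum_rightIdx (f : Fin (a + 1 + b + 1) → ℝ[X]) (i : Fin b) :
    tailSum f (rightIdx a i) = tailSum (fun k => f (rightNode a k)) i := by
  rw [tailSum_eq_sum_ite, tailSum_eq_sum_ite, sum_node, castSucc_rightIdx,
    Finset.sum_eq_zero fun k _ => if_neg (leftNode_lt_rightNode k _).not_gt, zero_add]
  simp only [rightNode_lt_rightNode]

lemma tailSum_midIdx (f : Fin (a + 1 + b + 1) → ℝ[X]) :
    tailSum f (midIdx a b) = ∑ k, f (rightNode a k) := by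
  rw [tailSum_eq_sum_ite, sum_node, castSucc_midIdx]
  simp only [leftNode_lt_rightNode, if_true, leftNode_lt_leftNode]
  rw [Finset.sum_eq_zero fun k _ => if_neg (Fin.le_last k).not_gt, zero_add]

lemma tailSum_leftIdx (f : Fin (a + 1 + b + 1) → ℝ[X]) (i : Fin a) :
    tailSum f (leftIdx b i) =
      tailSum (fun k => f (leftNode b k)) i + ∑ k, f (rightNode a k) := by
  rw [tailSum_eq_sum_ite, tailSum_eq_sum_ite, sum_node, castSucc_leftIdx]
  simp only [leftNode_lt_rightNode, if_true, leftNode_lt_leftNode]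

/-- The entries of a gluing outside the column of the inserted node below the diagonal. -/
structure IsBlockGluing (H₁ : Matrix (Fin a) (Fin a) ℝ) (H₂ : Matrix (Fin b) (Fin b) ℝ)
    (H : Matrix (Fin (a + 1 + b)) (Fin (a + 1 + b)) ℝ) : Prop where
  left_left : ∀ i j, H (leftIdx b i) (leftIdx b j) = H₁ i j
  left_mid : ∀ i, H (leftIdx b i) (midIdx a b) = 0
  left_right : ∀ (i : Fin a) (j : Fin b), H (leftIdx b i) (rightIdx a j) = 0
  mid_left : ∀ j, H (midIdx a b) (leftIdx b j) =
    -(((b : ℝ) + 1) / ((a : ℝ) + b + 2)) * ∑ k ∈ Finset.Ici j, H₁ k j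
  mid_mid : H (midIdx a b) (midIdx a b) =
    ((a : ℝ) + 1) * ((b : ℝ) + 1) / ((a : ℝ) + b + 2)
  mid_right : ∀ j, H (midIdx a b) (rightIdx a j) = 0
  right_left : ∀ (i : Fin b) (j : Fin a), H (rightIdx a i) (leftIdx b j) = 0
  right_right : ∀ i j, H (rightIdx a i) (rightIdx a j) = H₂ i j

section

variable {H₁ : Matrix (Fin a) (Fin a) ℝ} {H₂ : Matrix (Fin b) (Fin b) ℝ}
  {H : Matrix (Fin (a + 1 + b)) (Fin (a + 1 + b)) ℝ}

lemma IsGluing.isBlockGluing (h : IsGluing H₁ H₂ H) : IsBlockGluing H₁ H₂ H :=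
  ⟨h.left_left, h.left_mid, h.left_right, h.mid_left, h.mid_mid, h.mid_right, h.right_left,
    h.right_right⟩

lemma IsBlockGluing.isLowerTri (h : IsBlockGluing H₁ H₂ H) (h₁ : IsLowerTri H₁)
    (h₂ : IsLowerTri H₂) : IsLowerTri H := by
  intro i j hij
  induction i using idx_cases with
  | hl i =>
    induction j using idx_cases with
    | hl j => rw [h.left_left, h₁ i j hij]
    | hm => exact h.left_mid i
    | hr j => exact h.left_right i j
  | hm =>
    induction j using idx_cases with
    | hl j =>
      have := j.2
      simp only [Fin.lt_def, midIdx, leftIdx, Fin.val_castAdd, Fin.val_last,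
        Fin.val_castSucc] at hij
      omega
    | hm => exact absurd hij (lt_irrefl _)
    | hr j => exact h.mid_right j
  | hr i =>
    induction j using idx_cases with
    | hl j => exact h.right_left i j
    | hm =>
      simp only [Fin.lt_def, midIdx, rightIdx, Fin.val_castAdd, Fin.val_last,
        Fin.val_natAdd] at hij
      omega
    | hr j =>
      rw [h.right_right, h₂ i j]
      simp only [Fin.lt_def, rightIdx, Fin.val_natAdd] at hij ⊢
      omega

lemma IsBlockGluing.nodePoly_rightNode (h : IsBlockGluing H₁ H₂ H) (h₁ : IsLowerTri H₁)
    (h₂ : IsLowerTri H₂) : (fun k => nodePoly H (rightNode a k)) = nodePoly H₂ := by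
  have hf := isNodeFamily_nodePoly (h.isLowerTri h₁ h₂)
  refine IsNodeFamily.unique h₂ ⟨hf.1, fun j => ?_⟩ (isNodeFamily_nodePoly h₂)
  change nodePoly H (rightIdx a j).castSucc = _
  rw [hf.2, sum_idx]
  simp only [h.left_right, h.mid_right, h.right_right, zero_smul, Finset.sum_const_zero, zero_add,
    tailSum_rightIdx]

lemma IsBlockGluing.nodePoly_midIdx (h : IsBlockGluing H₁ H₂ H) (h₁ : IsLowerTri H₁)
    (h₂ : IsLowerTri H₂) : nodePoly H (midIdx a b).castSucc = (1 - X) *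
      -((((a : ℝ) + 1) * ((b : ℝ) + 1) / ((a : ℝ) + b + 2)) • ∑ k, nodePoly H₂ k +
        ∑ i, H (rightIdx a i) (midIdx a b) • tailSum (nodePoly H₂) i) := by
  have hr := h.nodePoly_rightNode h₁ h₂
  rw [(isNodeFamily_nodePoly (h.isLowerTri h₁ h₂)).2, sum_idx]
  simp only [h.left_mid, h.mid_mid, zero_smul, Finset.sum_const_zero, zero_add, tailSum_rightIdx,
    tailSum_midIdx, ← hr]

/-- Gluing multiplies the node polynomials of the left part by a multiple of `X ^ (b + 1)` and
keeps those of the right part. -/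
lemma IsBlockGluing.nodePoly_leftNode (h : IsBlockGluing H₁ H₂ H) (h₁ : IsLowerTri H₁)
    (h₂ : IsLowerTri H₂) (hI₂ : IsInvariant H₂)
    (hmid : nodePoly H (midIdx a b).castSucc = midPoly a b) (j : Fin a) :
    nodePoly H (leftNode b j.castSucc) =
      (((a : ℝ) + 1) / ((a : ℝ) + b + 2)) • (X ^ (b + 1) * nodePoly H₁ j.castSucc) := by
  set c : ℝ := ((a : ℝ) + 1) / ((a : ℝ) + b + 2) with hc
  have hN : (a : ℝ) + b + 2 ≠ 0 := by positivity
  have hM : (b : ℝ) + 1 ≠ 0 := by positivity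
  have hf := isNodeFamily_nodePoly (h.isLowerTri h₁ h₂)
  have hf₁ := isNodeFamily_nodePoly h₁
  have hr := h.nodePoly_rightNode h₁ h₂
  induction j using (wellFounded_gt (α := Fin a)).induction with
  | _ j ih =>
  -- the tails of `H₁` are rescaled and shifted by a constant, which the row of the inserted node
  -- cancels in the recursion
  have hS : ∀ i, j ≤ i → tailSum (nodePoly H) (leftIdx b i) =
      c • (X ^ (b + 1) * tailSum (nodePoly H₁) i) -
        (1 / ((a : ℝ) + b + 2)) • geomPoly b := by
    intro i hi
    rw [tailSum_leftIdx, tailSum_eq_succ, tailSum_eq_succ, nodePoly_last, ← castSucc_midIdx, hmid,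
      Finset.sum_congr rfl fun k hk => ih k (hi.trans_lt (Finset.mem_Ioi.1 hk)),
      ← Finset.smul_sum, ← Finset.mul_sum, Finset.sum_congr rfl fun k _ => congrFun hr k, hI₂,
      midPoly, mul_add (X ^ (b + 1)), smul_add, smul_sub, smul_smul]
    have e1 : ((a : ℝ) + 1) / (((a : ℝ) + b + 2) * ((b : ℝ) + 1)) * ((b : ℝ) + 1) = c := by
      rw [hc]
      field_simp
    have e2 : ((a : ℝ) + 1) / (((a : ℝ) + b + 2) * ((b : ℝ) + 1)) =
        1 / ((b : ℝ) + 1) - 1 / ((a : ℝ) + b + 2) := by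
      field_simp
      ring
    rw [e1, e2, sub_smul, mul_neg, mul_one, smul_neg]
    abel
  have hS' : ∑ k, nodePoly H (rightNode a k) = -((1 / ((b : ℝ) + 1)) • geomPoly b) := by
    rw [Finset.sum_congr rfl fun k _ => congrFun hr k, hI₂]
  rw [← castSucc_leftIdx, hf.2, hf₁.2, sum_idx]
  simp only [h.left_left, h.mid_left, h.right_left, zero_smul, Finset.sum_const_zero, add_zero,
    tailSum_midIdx, hS']
  rw [sum_eq_sum_Ici h₁, sum_eq_sum_Ici h₁,
    Finset.sum_congr rfl fun i hi => by rw [hS i (Finset.mem_Ici.1 hi)]]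
  simp only [smul_sub, Finset.sum_sub_distrib]
  rw [← Finset.sum_smul]
  have e3 : ∑ i ∈ Finset.Ici j, H₁ i j • c • (X ^ (b + 1) * tailSum (nodePoly H₁) i) =
      c • (X ^ (b + 1) * ∑ i ∈ Finset.Ici j, H₁ i j • tailSum (nodePoly H₁) i) := by
    rw [Finset.mul_sum, Finset.smul_sum]
    refine Finset.sum_congr rfl fun i _ => ?_
    rw [mul_smul_comm, smul_comm]
  rw [e3, smul_smul, smul_neg, smul_smul]
  have e4 : -(((b : ℝ) + 1) / ((a : ℝ) + b + 2)) * (∑ k ∈ Finset.Ici j, H₁ k j) *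
      (1 / ((b : ℝ) + 1)) = -((∑ k ∈ Finset.Ici j, H₁ k j) * (1 / ((a : ℝ) + b + 2))) := by
    field_simp
  rw [e4, neg_smul, neg_neg, sub_add_cancel]
  simp only [smul_eq_C_mul]
  ring

lemma IsBlockGluing.isInvariant (h : IsBlockGluing H₁ H₂ H) (h₁ : IsLowerTri H₁)
    (h₂ : IsLowerTri H₂) (hI₁ : IsInvariant H₁) (hI₂ : IsInvariant H₂)
    (hmid : nodePoly H (midIdx a b).castSucc = midPoly a b) : IsInvariant H := by
  have hN : (a : ℝ) + b + 2 ≠ 0 := by positivity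
  have hN' : (a : ℝ) + 1 + b + 1 ≠ 0 := by positivity
  have hM : (b : ℝ) + 1 ≠ 0 := by positivity
  have hN₁ : (a : ℝ) + 1 ≠ 0 := by positivity
  have hr := h.nodePoly_rightNode h₁ h₂
  have hs₁ : ∑ k, nodePoly H₁ (Fin.castSucc k) = 1 - (1 / ((a : ℝ) + 1)) • geomPoly a := by
    have := hI₁
    rw [IsInvariant, Fin.sum_univ_castSucc, nodePoly_last] at this
    linear_combination this
  rw [IsInvariant, sum_node, Fin.sum_univ_castSucc, ← castSucc_midIdx, hmid,
    Finset.sum_congr rfl fun k _ => h.nodePoly_leftNode h₁ h₂ hI₂ hmid k,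
    Finset.sum_congr rfl fun k _ => congrFun hr k, hI₂, ← Finset.smul_sum, ← Finset.mul_sum, hs₁,
    geomPoly_glue, midPoly]
  ext d
  simp only [coeff_add, coeff_smul, coeff_neg, coeff_sub, mul_sub, mul_one, mul_smul_comm,
    smul_eq_mul, Nat.cast_add, Nat.cast_one]
  field_simp
  ring

lemma ip_midPoly {q : ℝ[X]} (hq : q.natDegree ≤ b) : ip (midPoly a b) q =
    ((a : ℝ) + 1) / (((a : ℝ) + b + 2) * ((b : ℝ) + 1)) * q.eval 1 := by
  rw [midPoly, map_smul, LinearMap.smul_apply, map_sub, LinearMap.sub_apply, ip_geomPoly hq,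
    map_smul, LinearMap.smul_apply, ip_X_pow, coeff_eq_zero_of_natDegree_lt (by omega)]
  simp

lemma ip_X_pow_mul_midPoly (q : ℝ[X]) : ip (X ^ (b + 1) * q) (midPoly a b) =
    -(((a : ℝ) + 1) / ((a : ℝ) + b + 2) * q.coeff 0) := by
  have hM : (b : ℝ) + 1 ≠ 0 := by positivity
  have hN : (a : ℝ) + b + 2 ≠ 0 := by positivity
  have h : ip (X ^ (b + 1) * q) (X ^ (b + 1)) = q.coeff 0 := by
    have h1 := ip_X_pow_mul (b + 1) q 1
    rw [mul_one] at h1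
    rw [h1, ip_comm]
    simpa using ip_X_pow 0 q
  rw [midPoly, map_smul, map_sub, map_smul, h, ip_X_pow_mul_of_natDegree_lt _
    ((natDegree_geomPoly_le b).trans_lt (Nat.lt_succ_self b))]
  simp only [smul_eq_mul]
  field_simp
  ring

/-! ### Arcs of gluings -/

lemma IsGluing.nodePoly_midIdx (h : IsGluing H₁ H₂ H) :
    nodePoly H (leftNode b (Fin.last a)) = midPoly a b :=
  (nodePoly_mid_eq_iff H).2 h.column

lemma IsGluing.nodePoly_leftNode (h : IsGluing H₁ H₂ H) (j : Fin a) :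
    nodePoly H (leftNode b j.castSucc) =
      (((a : ℝ) + 1) / ((a : ℝ) + b + 2)) • (X ^ (b + 1) * nodePoly H₁ j.castSucc) :=
  h.isBlockGluing.nodePoly_leftNode h.mem_left.1 h.mem_right.1
    (isInvariant_of_mem_optimalSet h.mem_right) h.nodePoly_midIdx j

lemma IsGluing.nodePoly_rightNode (h : IsGluing H₁ H₂ H) (k : Fin (b + 1)) :
    nodePoly H (rightNode a k) = nodePoly H₂ k :=
  congrFun (h.isBlockGluing.nodePoly_rightNode h.mem_left.1 h.mem_right.1) k

lemma IsGluing.ip_left_left (h : IsGluing H₁ H₂ H) (j : Fin a) (k : Fin (a + 1)) :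
    ip (nodePoly H (leftNode b j.castSucc)) (nodePoly H (leftNode b k)) =
      (((a : ℝ) + 1) / ((a : ℝ) + b + 2)) ^ 2 *
        ip (nodePoly H₁ j.castSucc) (nodePoly H₁ k) := by
  rw [h.nodePoly_leftNode]
  induction k using Fin.lastCases with
  | last =>
    have h1 := ip_X_pow 0 (nodePoly H₁ j.castSucc)
    rw [pow_zero] at h1
    rw [h.nodePoly_midIdx, nodePoly_last, map_neg, map_smul, LinearMap.smul_apply,
      ip_X_pow_mul_midPoly, ip_comm _ 1, h1, smul_eq_mul]
    ring
  | cast k =>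
    rw [h.nodePoly_leftNode, map_smul, map_smul, LinearMap.smul_apply, ip_X_pow_mul, smul_eq_mul,
      smul_eq_mul]
    ring

lemma IsGluing.ip_left_right (h : IsGluing H₁ H₂ H) (j : Fin a) (k : Fin (b + 1)) :
    ip (nodePoly H (leftNode b j.castSucc)) (nodePoly H (rightNode a k)) = 0 := by
  rw [h.nodePoly_leftNode, h.nodePoly_rightNode, map_smul, LinearMap.smul_apply,
    ip_X_pow_mul_of_natDegree_lt, smul_zero]
  exact (natDegree_nodePoly_le h.mem_right.1 k).trans_lt (by omega)

lemma IsGluing.ip_mid_right (h : IsGluing H₁ H₂ H) (k : Fin (b + 1)) :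
    ip (nodePoly H (leftNode b (Fin.last a))) (nodePoly H (rightNode a k)) =
      if k = Fin.last b then -(((a : ℝ) + 1) / (((a : ℝ) + b + 2) * ((b : ℝ) + 1))) else 0 := by
  rw [h.nodePoly_midIdx, h.nodePoly_rightNode, ip_midPoly
    ((natDegree_nodePoly_le h.mem_right.1 k).trans (by omega))]
  induction k using Fin.lastCases with
  | last => simp [nodePoly_last]
  | cast k => simp [eval_one_nodePoly h.mem_right.1, (Fin.castSucc_lt_last k).ne]

lemma IsGluing.mem_optimalSet (h : IsGluing H₁ H₂ H) : H ∈ optimalSet (a + 1 + b) := by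
  obtain ⟨hL₁, hI₁, hC₁⟩ := mem_optimalSet_iff.1 h.mem_left
  obtain ⟨hL₂, hI₂, hC₂⟩ := mem_optimalSet_iff.1 h.mem_right
  refine mem_optimalSet_of_isCertified (h.isBlockGluing.isLowerTri hL₁ hL₂)
    (h.isBlockGluing.isInvariant hL₁ hL₂ hI₁ hI₂ h.nodePoly_midIdx) fun j k hjk => ?_
  have hN : (0 : ℝ) ≤ ((a + 1 + b : ℕ) : ℝ) + 1 := by positivity
  rw [cert_eq_ip]
  refine mul_nonneg_of_nonpos_of_nonpos (neg_nonpos.2 hN) ?_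
  induction j using idx_cases with
  | hl j =>
    rw [castSucc_leftIdx] at hjk ⊢
    induction k using node_cases with
    | hl k =>
      rw [h.ip_left_left]
      exact mul_nonpos_of_nonneg_of_nonpos (sq_nonneg _)
        (hC₁.ip_nonpos (leftNode_lt_leftNode.1 hjk))
    | hr k => rw [h.ip_left_right]
  | hm =>
    rw [castSucc_midIdx] at hjk ⊢
    induction k using node_cases with
    | hl k => exact absurd (leftNode_lt_leftNode.1 hjk) (Fin.le_last k).not_gt
    | hr k =>
      rw [h.ip_mid_right]
      split_ifs
      · exact neg_nonpos.2 (by positivity)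
      · exact le_rfl
  | hr j =>
    rw [castSucc_rightIdx] at hjk ⊢
    induction k using node_cases with
    | hl k => exact absurd hjk (leftNode_lt_rightNode k _).not_gt
    | hr k =>
      rw [h.nodePoly_rightNode, h.nodePoly_rightNode]
      exact hC₂.ip_nonpos (rightNode_lt_rightNode.1 hjk)

lemma IsGluing.isArc_left_left (h : IsGluing H₁ H₂ H) (j : Fin a) (k : Fin (a + 1)) :
    IsArc H (leftIdx b j) (leftNode b k) ↔ IsArc H₁ j k := by
  have hc : 0 < (((a : ℝ) + 1) / ((a : ℝ) + b + 2)) ^ 2 := by positivity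
  rw [isArc_iff_ip_neg, isArc_iff_ip_neg, castSucc_leftIdx, leftNode_lt_leftNode, h.ip_left_left]
  exact and_congr_right fun _ => by simp only [mul_neg_iff, hc, hc.not_gt, true_and, false_and,
    or_false]

lemma IsGluing.not_isArc_left_right (h : IsGluing H₁ H₂ H) (j : Fin a) (k : Fin (b + 1)) :
    ¬ IsArc H (leftIdx b j) (rightNode a k) := by
  rw [isArc_iff_ip_neg, castSucc_leftIdx, h.ip_left_right]
  exact fun h => lt_irrefl _ h.2

lemma IsGluing.isArc_mid_right (h : IsGluing H₁ H₂ H) (k : Fin (b + 1)) :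
    IsArc H (midIdx a b) (rightNode a k) ↔ k = Fin.last b := by
  rw [isArc_iff_ip_neg, castSucc_midIdx, h.ip_mid_right]
  have hc : 0 < ((a : ℝ) + 1) / (((a : ℝ) + b + 2) * ((b : ℝ) + 1)) := by positivity
  split_ifs with hk
  · simpa [hk, leftNode_lt_rightNode] using hc
  · simp [hk]

lemma IsGluing.isArc_right_right (h : IsGluing H₁ H₂ H) (j : Fin b) (k : Fin (b + 1)) :
    IsArc H (rightIdx a j) (rightNode a k) ↔ IsArc H₂ j k := by
  rw [isArc_iff_ip_neg, isArc_iff_ip_neg, castSucc_rightIdx, rightNode_lt_rightNode,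
    h.nodePoly_rightNode, h.nodePoly_rightNode]

end

/-- The column of the inserted node exists: its entries are coordinates of a polynomial of degree
less than `b` in a triangular basis. -/
theorem exists_isGluing {H₁ : Matrix (Fin a) (Fin a) ℝ} {H₂ : Matrix (Fin b) (Fin b) ℝ}
    (h₁ : H₁ ∈ optimalSet a) (h₂ : H₂ ∈ optimalSet b) : ∃ H, IsGluing H₁ H₂ H := by
  obtain ⟨hL₂, hI₂, -⟩ := mem_optimalSet_iff.1 h₂
  have hN : (a : ℝ) + b + 2 ≠ 0 := by positivity
  have hM : (b : ℝ) + 1 ≠ 0 := by positivity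
  set r : ℝ := ((a : ℝ) + 1) / ((a : ℝ) + b + 2) with hr
  obtain ⟨c, hc⟩ := exists_sum_smul_eq_of_triangular (tailSum (nodePoly H₂))
    (fun i => (tailSum_nodePoly_triangular hL₂ hI₂ i).1)
    (fun i => (tailSum_nodePoly_triangular hL₂ hI₂ i).2)
    (r • (geomPoly b - (1 / ((b : ℝ) + 1)) • derivative (geomPoly (b + 1)))) (fun d hd => by
      rw [coeff_smul, coeff_sub, coeff_smul, coeff_derivative, coeff_geomPoly, coeff_geomPoly]
      rcases hd.eq_or_lt with rfl | hd
      · simp [hM]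
      · rw [if_neg (by omega), if_neg (by omega)]
        simp)
  -- the diagonal entry of the column matches the leading coefficient of the polynomial `midPoly`,
  -- and `c` supplies the entries below it
  set H : Matrix (Fin (a + 1 + b)) (Fin (a + 1 + b)) ℝ := Fin.addCases
    (Fin.lastCases
      (Fin.addCases (Fin.lastCases (((a : ℝ) + 1) * ((b : ℝ) + 1) / ((a : ℝ) + b + 2))
        fun j => -(((b : ℝ) + 1) / ((a : ℝ) + b + 2)) * ∑ k ∈ Finset.Ici j, H₁ k j) fun _ => 0)
      (fun i => Fin.addCases (Fin.lastCases 0 (H₁ i)) fun _ => 0))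
    (fun i => Fin.addCases (Fin.lastCases (c i) fun _ => 0) (H₂ i)) with hH
  have hblock : IsBlockGluing H₁ H₂ H := by
    constructor <;> intros <;> simp [hH, leftIdx, midIdx, rightIdx]
  have hcol : ∀ i, H (rightIdx a i) (midIdx a b) = c i := by
    intro i
    simp [hH, midIdx, rightIdx]
  refine ⟨H, h₁, h₂, hblock.1, hblock.2, hblock.3, hblock.4, hblock.5, hblock.6, hblock.7,
    hblock.8, (nodePoly_mid_eq_iff H).1 ?_⟩
  rw [hblock.nodePoly_midIdx h₁.1 hL₂, midPoly_eq]
  simp only [hcol]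
  rw [← hc, hI₂]
  congr 1
  ext d
  simp only [coeff_neg, coeff_add, coeff_smul, coeff_sub, smul_eq_mul, hr]
  field_simp
  ring

/-! ### Basic matrices and non-crossing trees -/

/-- `κ` maps each of the nodes `0, …, n - 1` to a later node, at most `n`, without crossings. -/
def IsPlanarTree (n : ℕ) (κ : ℕ → ℕ) : Prop :=
  ∀ j < n, j < κ j ∧ κ j ≤ n ∧ ∀ i < j, j < κ i → κ j ≤ κ i

/-- The arcs of `H` are `(κ j, j)`. -/
def HasArcs {n : ℕ} (H : Matrix (Fin n) (Fin n) ℝ) (κ : ℕ → ℕ) : Prop :=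
  ∀ (j : Fin n) (k : Fin (n + 1)), IsArc H j k ↔ (k : ℕ) = κ j

lemma IsGluing.hasArcs {H₁ : Matrix (Fin a) (Fin a) ℝ} {H₂ : Matrix (Fin b) (Fin b) ℝ}
    {H : Matrix (Fin (a + 1 + b)) (Fin (a + 1 + b)) ℝ} (h : IsGluing H₁ H₂ H) {κ κ₁ κ₂ : ℕ → ℕ}
    (h₁ : HasArcs H₁ κ₁) (h₂ : HasArcs H₂ κ₂) (hκ₁ : ∀ j < a, κ j = κ₁ j ∧ κ₁ j ≤ a)
    (hκ : κ a = a + 1 + b) (hκ₂ : ∀ j < b, κ (a + 1 + j) = a + 1 + κ₂ j) : HasArcs H κ := by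
  intro j k
  induction j using idx_cases with
  | hl j =>
    obtain ⟨e, he⟩ := hκ₁ j j.2
    have e' : κ (leftIdx b j) = κ j := rfl
    induction k using node_cases with
    | hl k => rw [h.isArc_left_left, h₁, e', e, val_leftNode]
    | hr k =>
      refine iff_of_false (h.not_isArc_left_right j k) ?_
      rw [e', e, val_rightNode]
      omega
  | hm =>
    have e' : κ (midIdx a b) = a + 1 + b := hκ
    induction k using node_cases with
    | hl k =>
      refine iff_of_false (fun hk => absurd hk.1 (Fin.le_last k).not_gt) ?_
      rw [e', val_leftNode]
      omega
    | hr k =>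
      rw [h.isArc_mid_right, e', val_rightNode, Fin.ext_iff, Fin.val_last]
      omega
  | hr j =>
    have e' : κ (rightIdx a j) = a + 1 + κ₂ j := hκ₂ j j.2
    induction k using node_cases with
    | hl k =>
      refine iff_of_false (fun hk => absurd hk.1 (leftNode_lt_rightNode k j.castSucc).not_gt) ?_
      rw [e', val_leftNode]
      omega
    | hr k =>
      rw [h.isArc_right_right, h₂, e', val_rightNode]
      omega

/-- Basic matrices are optimal, and their arc diagrams are non-crossing trees. -/
theorem IsBasic.exists_hasArcs {n : ℕ} {H : Matrix (Fin n) (Fin n) ℝ} (h : IsBasic H) :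
    H ∈ optimalSet n ∧ ∃ κ, IsPlanarTree n κ ∧ HasArcs H κ := by
  induction h with
  | empty H =>
    refine ⟨mem_optimalSet_of_isCertified (fun i => i.elim0) ?_ (fun j => j.elim0), id,
      fun j hj => absurd hj (Nat.not_lt_zero j), fun j => j.elim0⟩
    have h := nodePoly_last H
    rw [IsInvariant, Fin.sum_univ_castSucc, h]
    simp [geomPoly]
  | @glue a b H₁ H₂ H _ _ h ih₁ ih₂ =>
    obtain ⟨-, κ₁, hp₁, ha₁⟩ := ih₁
    obtain ⟨-, κ₂, hp₂, ha₂⟩ := ih₂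
    refine ⟨h.mem_optimalSet, fun j => if j < a then κ₁ j else if j = a then a + 1 + b else
      a + 1 + κ₂ (j - (a + 1)), fun j hj => ?_, h.hasArcs ha₁ ha₂ (fun j hj => ?_) ?_
      fun j hj => ?_⟩
    · dsimp only
      rcases lt_trichotomy j a with hja | rfl | hja
      · have h1 := hp₁ j hja
        rw [if_pos hja]
        refine ⟨h1.1, by omega, fun i hi hij => ?_⟩
        rw [if_pos (hi.trans hja)] at hij ⊢
        exact h1.2.2 i hi hij
      · rw [if_neg (lt_irrefl _), if_pos rfl]
        refine ⟨by omega, le_rfl, fun i hi hij => ?_⟩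
        rw [if_pos hi] at hij
        have := (hp₁ i hi).2.1
        omega
      · obtain ⟨l, rfl⟩ : ∃ l, j = a + 1 + l := ⟨j - (a + 1), by omega⟩
        have h1 := hp₂ l (by omega)
        rw [if_neg (by omega), if_neg (by omega), Nat.add_sub_cancel_left]
        refine ⟨by omega, by omega, fun i hi hij => ?_⟩
        rcases lt_trichotomy i a with hia | rfl | hia
        · rw [if_pos hia] at hij
          have := (hp₁ i hia).2.1
          omega
        · rw [if_neg (lt_irrefl _), if_pos rfl]
          omega
        · obtain ⟨m, rfl⟩ : ∃ m, i = a + 1 + m := ⟨i - (a + 1), by omega⟩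
          rw [if_neg (by omega), if_neg (by omega), Nat.add_sub_cancel_left] at hij ⊢
          have := h1.2.2 m (by omega) (by omega)
          omega
    · exact ⟨if_pos hj, (hp₁ j hj).2.1⟩
    · rw [if_neg (lt_irrefl _), if_pos rfl]
    · rw [if_neg (by omega), if_neg (by omega), Nat.add_sub_cancel_left]

/-- Every non-crossing tree is the arc diagram of a basic matrix: the tree is cut at the first
child of the root. -/
theorem exists_isBasic_hasArcs (n : ℕ) (κ : ℕ → ℕ) (hκ : IsPlanarTree n κ) :
    ∃ H : Matrix (Fin n) (Fin n) ℝ, IsBasic H ∧ HasArcs H κ := by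
  induction n using Nat.strong_induction_on generalizing κ with
  | _ n ih =>
    rcases Nat.eq_zero_or_pos n with rfl | hn
    · exact ⟨0, IsBasic.empty 0, fun j => j.elim0⟩
    -- the first child of the root becomes the inserted node
    have hex : ∃ j, j < n ∧ κ j = n := by
      refine ⟨n - 1, by omega, ?_⟩
      have := hκ (n - 1) (by omega)
      omega
    classical
    obtain ⟨han, haκ⟩ := Nat.find_spec hex
    have hmin : ∀ j < Nat.find hex, κ j ≠ n := fun j hj h =>
      Nat.find_min hex hj ⟨hj.trans han, h⟩
    generalize Nat.find hex = a at han haκ hmin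
    obtain ⟨b, rfl⟩ : ∃ b, n = a + 1 + b := ⟨n - (a + 1), by omega⟩
    -- an arc from before `a` to beyond `a` would cross the arc from `a` to the root
    have hleft : ∀ j < a, κ j ≤ a := by
      intro j hj
      by_contra! h
      have h1 := (hκ a han).2.2 j hj h
      have h2 := (hκ j (hj.trans han)).2.1
      have h3 := hmin j hj
      omega
    obtain ⟨H₁, hb₁, ha₁⟩ := ih a (by omega) κ fun j hj =>
      ⟨(hκ j (by omega)).1, hleft j hj, (hκ j (by omega)).2.2⟩
    obtain ⟨H₂, hb₂, ha₂⟩ := ih b (by omega) (fun j => κ (a + 1 + j) - (a + 1)) fun j hj => by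
      have h1 := hκ (a + 1 + j) (by omega)
      dsimp only
      refine ⟨by omega, by omega, fun i hi hij => ?_⟩
      have := h1.2.2 (a + 1 + i) (by omega) (by omega)
      omega
    obtain ⟨H, hH⟩ := exists_isGluing hb₁.exists_hasArcs.1 hb₂.exists_hasArcs.1
    refine ⟨H, IsBasic.glue H₁ H₂ H hb₁ hb₂ hH, hH.hasArcs ha₁ ha₂
      (fun j hj => ⟨rfl, hleft j hj⟩) haκ fun j hj => ?_⟩
    have := (hκ (a + 1 + j) (by omega)).1
    omega

lemma HasArcs.isTree {n : ℕ} {H : Matrix (Fin n) (Fin n) ℝ} {κ : ℕ → ℕ} (h : HasArcs H κ)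
    (hκ : IsPlanarTree n κ) : IsTree H := fun j =>
  ⟨⟨κ j, Nat.lt_succ_of_le (hκ j j.2).2.1⟩, (h j _).2 rfl, fun k hk => Fin.ext ((h j k).1 hk)⟩

/-- The vertices are the optimal matrices whose arc diagrams are trees. -/
theorem isVertex_iff_isTree {n : ℕ} (H : Matrix (Fin n) (Fin n) ℝ) :
    IsVertex H ↔ H ∈ optimalSet n ∧ IsTree H := by
  have hstar : IsPlanarTree n fun _ => n := fun j hj => ⟨hj, le_rfl, fun _ _ _ => le_rfl⟩
  obtain ⟨H₀, hb, ha⟩ := exists_isBasic_hasArcs n _ hstar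
  exact isVertex_iff hb.exists_hasArcs.1 (ha.isTree hstar) H

theorem isBasic_iff {n : ℕ} (H : Matrix (Fin n) (Fin n) ℝ) :
    IsBasic H ↔ IsVertex H ∧ NonCrossing H := by
  rw [isVertex_iff_isTree]
  constructor
  · intro h
    obtain ⟨hopt, κ, hκ, ha⟩ := h.exists_hasArcs
    refine ⟨⟨hopt, ha.isTree hκ⟩, fun j₁ j₂ k₁ k₂ h₁ h₂ ⟨h12, h21, hk⟩ => ?_⟩
    rw [ha] at h₁ h₂
    have := (hκ j₂ j₂.2).2.2 j₁ h12
    simp only [Fin.lt_def, Fin.val_castSucc] at h12 h21 hk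
    omega
  · rintro ⟨⟨hopt, ht⟩, hnc⟩
    choose κ hκ using fun j => (ht j).exists
    have hu : ∀ j k, IsArc H j k ↔ k = κ j := fun j k =>
      ⟨fun hk => (ht j).unique hk (hκ j), fun hk => hk ▸ hκ j⟩
    set κ' : ℕ → ℕ := fun j => if hj : j < n then κ ⟨j, hj⟩ else 0 with hκ'
    have hκ'j : ∀ j : Fin n, κ' j = κ j := fun j => by simp [hκ']
    have hplanar : IsPlanarTree n κ' := by
      intro j hj
      have e : κ' j = κ ⟨j, hj⟩ := hκ'j ⟨j, hj⟩
      rw [e]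
      refine ⟨(hκ ⟨j, hj⟩).1, by omega, fun i hi hij => ?_⟩
      have e' : κ' i = κ ⟨i, hi.trans hj⟩ := hκ'j ⟨i, hi.trans hj⟩
      rw [e'] at hij ⊢
      by_contra! hlt
      exact hnc _ _ _ _ (hκ ⟨i, hi.trans hj⟩) (hκ ⟨j, hj⟩) ⟨hi, hij, hlt⟩
    obtain ⟨H', hb, ha⟩ := exists_isBasic_hasArcs n κ' hplanar
    have hu' : ∀ j k, IsArc H' j k ↔ k = κ j := fun j k => by
      rw [ha, hκ'j, Fin.ext_iff]
    rwa [eq_of_same_arcs hopt hb.exists_hasArcs.1 κ hu hu']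

end FixedPointAlg

/-- With `n = N - 1`: every vertex `H` of `ℋ⋆(N - 1)` has exactly one arc `(k(j), j)` for each
`j = 1, …, N - 1`, and an arbitrary `H` is basic if and only if it is a vertex of `ℋ⋆(N - 1)`
whose arc diagram is non-crossing. -/
theorem mainTheorem6 (n : ℕ) (H : Matrix (Fin n) (Fin n) ℝ) :
    (FixedPointAlg.IsVertex H → ∀ j : Fin n, ∃! k : Fin (n + 1), FixedPointAlg.IsArc H j k) ∧
    (FixedPointAlg.IsBasic H ↔ FixedPointAlg.IsVertex H ∧ FixedPointAlg.NonCrossing H) :=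
  ⟨fun h => ((FixedPointAlg.isVertex_iff_isTree H).1 h).2, FixedPointAlg.isBasic_iff H⟩
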